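/- Let $d>1$ be odd, let $0\le r_0<r_1\le\infty$, $r_0<\infty$, and let $A(r_0,r_1)=\{x\in\mathbb{R}^d: r_0<|x|<r_1\}$. Let $\tau\ge 0$ satisfy $\tau<1/(2r_0)$ (with $1/0=\infty$ throughout), and let $f:A(r_0,r_1)\to\mathbb{C}$ be polyharmonic of infinite order and type $\tau$, i.e. $f$ is $C^\infty$ and for every compact $K\subset A(r_0,r_1)$ and every $\varepsilon>0$ there is a constant $C_{K,\varepsilon}>0$ such that $\max_{x\in K}|\Delta^p f(x)|\le C_{K,\varepsilon}\,(2p)!\,(\tau+\varepsilon)^{2p}$ for all $p\in\mathbb{N}_0$. For each $k\in\mathbb{N}_0$ let $Y_{k,l}$, $l=1,\dots,a_k$, be a basis of the space of harmonic homogeneous polynomials of degree $k$ on $\mathbb{R}^d$ that is orthonormal with respect to $\langle g,h\rangle=\int_{\mathbb{S}^{d-1}}g(\theta)\overline{h(\theta)}\,d\theta$, where $d\theta$ is the rotation invariant surface measure on $\mathbb{S}^{d-1}$, and let $$f_{k,l}(r)=\int_{\mathbb{S}^{d-1}}f(r\theta)\overline{Y_{k,l}(\theta)}\,d\theta,\qquad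 r_0<r<r_1,$$ be the Fourier--Laplace coefficients of $f$. Then for each $k\in\mathbb{N}_0$ and $l=1,\dots,a_k$ there exist complex numbers $a_{k,l,j}$, $j\in\mathbb{N}_0$, such that the series $$F_{k,l}(z)=z^k\sum_{j=0}^\infty a_{k,l,2j}z^{2j}+z^{-k-d+2}\sum_{j=0}^\infty a_{k,l,2j+1}z^{2j}$$ converges absolutely, and uniformly on compact subsets, in the annulus $\{z\in\mathbb{C}:0<|z|<1/(2\tau)\}$, its sum $F_{k,l}$ is analytic there, and $F_{k,l}(r)=f_{k,l}(r)$ for all $r$ with $r_0<r<\min\{r_1,1/(2\tau)\}$. Moreover, the power series $\sum_{j}a_{k,l,2j}z^{2j}$ and $\sum_{j}a_{k,l,2j+1}z^{2j}$ have radius of convergence at least $1/(2\tau)$; in particular, their sums are entire functions if $\tau=0$. -/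

import Mathlib

open MeasureTheory Laplacian
open scoped NNReal ENNReal ContDiff ComplexConjugate

noncomputable section

/-- The open annular region `{x : r₀ < |x| < r₁}`, where `0 ≤ r₀` and `r₁ ≤ ∞`. -/
def annulus (E : Type*) [NormedAddCommGroup E] (r₀ r₁ : ℝ≥0∞) : Set E :=
  {x | r₀ < ‖x‖ₑ ∧ ‖x‖ₑ < r₁}

/-- `f` is polyharmonic of infinite order and type `τ` on `G` (used for open `G`, so that the
iterated Laplacians on `G` depend only on the restriction of `f` to `G`). -/
def IsPolyharmonicInfiniteOrder {d : ℕ} (G : Set (EuclideanSpace ℝ (Fin d))) (τ : ℝ)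
    (f : EuclideanSpace ℝ (Fin d) → ℂ) : Prop :=
  ContDiffOn ℝ ∞ f G ∧
    ∀ K : Set (EuclideanSpace ℝ (Fin d)), IsCompact K → K ⊆ G → ∀ ε : ℝ, 0 < ε →
      ∃ C : ℝ, 0 < C ∧ ∀ p : ℕ, ∀ x ∈ K,
        ‖((fun g : EuclideanSpace ℝ (Fin d) → ℂ => Δ g)^[p] f) x‖ ≤
          C * (Nat.factorial (2 * p) : ℝ) * (τ + ε) ^ (2 * p)

/-- The Laplacian on polynomials in `d` variables. -/
def polyLaplacian (d : ℕ) : MvPolynomial (Fin d) ℂ →ₗ[ℂ] MvPolynomial (Fin d) ℂ :=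
  ∑ i : Fin d, (MvPolynomial.pderiv i).toLinearMap ∘ₗ (MvPolynomial.pderiv i).toLinearMap

/-- The space of harmonic homogeneous polynomials of degree `k` in `d` variables. -/
def harmonicHomogeneous (d k : ℕ) : Submodule ℂ (MvPolynomial (Fin d) ℂ) :=
  MvPolynomial.homogeneousSubmodule (Fin d) ℂ k ⊓ LinearMap.ker (polyLaplacian d)

/-- The dimension `a_k` of the space of harmonic homogeneous polynomials of degree `k`. -/
def harmonicDim (d k : ℕ) : ℕ := Module.finrank ℂ (harmonicHomogeneous d k)

/-- The value of a polynomial at a point of `ℝ^d`. -/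
def evalReal {d : ℕ} (P : MvPolynomial (Fin d) ℂ) (x : EuclideanSpace ℝ (Fin d)) : ℂ :=
  MvPolynomial.eval (fun i => ((x i : ℝ) : ℂ)) P

/-- The rotation invariant surface measure `dθ` on the unit sphere of `ℝ^d`. -/
abbrev surfaceMeasure (d : ℕ) :
    Measure (Metric.sphere (0 : EuclideanSpace ℝ (Fin d)) 1) :=
  (volume : Measure (EuclideanSpace ℝ (Fin d))).toSphere

/-- The family `Y` consists, for each `k`, of a basis of the harmonic homogeneous polynomials of
degree `k` that is orthonormal for the scalar product `∫ g(θ) conj(h(θ)) dθ` of the unit sphere. -/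
def IsSphereOrthonormal {d : ℕ}
    (Y : ∀ k : ℕ, Module.Basis (Fin (harmonicDim d k)) ℂ (harmonicHomogeneous d k)) : Prop :=
  ∀ (k : ℕ) (l m : Fin (harmonicDim d k)),
    ∫ θ, evalReal (Y k l : MvPolynomial (Fin d) ℂ) θ.1 *
        conj (evalReal (Y k m : MvPolynomial (Fin d) ℂ) θ.1) ∂(surfaceMeasure d) =
      if l = m then 1 else 0

/-- The Fourier-Laplace coefficient `r ↦ ∫ f(rθ) conj(P(θ)) dθ` of `f` with respect to `P`. -/
def fourierLaplaceCoeff {d : ℕ} (f : EuclideanSpace ℝ (Fin d) → ℂ)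
    (P : MvPolynomial (Fin d) ℂ) (r : ℝ) : ℂ :=
  ∫ θ, f (r • θ.1) * conj (evalReal P θ.1) ∂(surfaceMeasure d)

/-- The exponents `λ_{2j}(k) = k + 2j` and `λ_{2j+1}(k) = -k - d + 2 + 2j`. -/
def expo (d k n : ℕ) : ℤ :=
  if Even n then (k : ℤ) + 2 * (n / 2 : ℕ) else -(k : ℤ) - d + 2 + 2 * (n / 2 : ℕ)

/-- The function `∑_j a_{2j} z^{2j}`. -/
def evenPart (a : ℕ → ℂ) (z : ℂ) : ℂ := ∑' j : ℕ, a (2 * j) * z ^ (2 * j)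

/-- The function `∑_j a_{2j+1} z^{2j}`. -/
def oddPart (a : ℕ → ℂ) (z : ℂ) : ℂ := ∑' j : ℕ, a (2 * j + 1) * z ^ (2 * j)

/-- The function `z^k ∑_j a_{2j} z^{2j} + z^{-k-d+2} ∑_j a_{2j+1} z^{2j}`. -/
def laurentExtension (d k : ℕ) (a : ℕ → ℂ) (z : ℂ) : ℂ :=
  z ^ k * evenPart a z + z ^ (-(k : ℤ) - d + 2) * oddPart a z

/-- The formal power series `∑_j a_{2j} z^{2j}`. -/
def evenSeries (a : ℕ → ℂ) : FormalMultilinearSeries ℂ ℂ ℂ :=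
  FormalMultilinearSeries.ofScalars ℂ (fun n => if Even n then a n else 0)

/-- The formal power series `∑_j a_{2j+1} z^{2j}`. -/
def oddSeries (a : ℕ → ℂ) : FormalMultilinearSeries ℂ ℂ ℂ :=
  FormalMultilinearSeries.ofScalars ℂ (fun n => if Even n then a (n + 1) else 0)

end

open Set Filter Topology

/-! Write `d = 2e + 3` and let `g_p` be the coefficient of `Δ^p f` against a fixed spherical
harmonic of degree `k`. Separating the Laplacian into radial and angular parts gives `g_{p+1} =
g_p'' + (d-1)/r g_p' - k(k+d-2)/r² g_p`. The Euler operator on the right has exponents `k` and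
`-k-d+2`. Multiplying by `r^(k+d-2)` moves them to `2n+1` and `0` with `n = k+e`: for `y_p =
r^(k+d-2) g_p` one gets `y_{p+1} = y_p'' - (2n/r) y_p'`.

Because `d` is odd, `n` is a natural number, and the substitution `y ↦ y'/r` lowers `n` by one
(`IsRadialChain.descend`). After `n` steps the operator is `d²/dr²`, so the chain lists the even
derivatives of one function. Growth `(2p)! (τ+ε)^(2p)` of `y_p` passes to first derivatives by a
Landau estimate (`IsRadialChain.hasGrowthType_snd`), so all derivatives of order `m` are of size `m!
(τ+ε)^m`. Taylor series at a point `ρ < 1/(2τ)` then have radius at least `1/τ`, and their discs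
contain the disc of radius `1/(2τ)` about `0` (`exists_powerSeries_of_deriv_growth`).

Undoing each step by integrating `r · Σ c_j r^j` shifts indices by two and creates no linear term.
Hence `y_0` is a power series whose odd coefficients below `2n+1` vanish
(`IsRadialChain.exists_powerSeries`). Dividing by `r^(k+d-2)`, the even terms give the singular part
and the odd ones the part starting with `r^k`. -/

/-! ### Growth classes of sequences of functions -/

/-- The sequence `y` of functions on `I` grows at most like `(2p)! (τ + ε)^(2p)`, for each `ε > 0`
and uniformly on compact subintervals of `I`. -/
def HasGrowthType (I : Set ℝ) (τ : ℝ) (y : ℕ → ℝ → ℂ) : Prop :=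
  ∀ a b : ℝ, Icc a b ⊆ I → ∀ ε : ℝ, 0 < ε → ∃ C : ℝ, 0 ≤ C ∧ ∀ p : ℕ, ∀ r ∈ Icc a b,
    ‖y p r‖ ≤ C * (Nat.factorial (2 * p) : ℝ) * (τ + ε) ^ (2 * p)

/-- Passing from `(2p)!` to `(2p+2)!` costs a quadratic factor in `p`, which the geometric gain from
replacing `τ + ε/2` by `τ + ε` absorbs. -/
lemma HasGrowthType.shift {I : Set ℝ} {τ : ℝ} (hτ : 0 ≤ τ) {y : ℕ → ℝ → ℂ}
    (hy : HasGrowthType I τ y) : HasGrowthType I τ (fun p => y (p + 1)) := by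
  intro a b hab ε hε
  obtain ⟨C, hC, h⟩ := hy a b hab (ε / 2) (by positivity)
  set q := (τ + ε / 2) / (τ + ε) with hq
  have hq0 : 0 ≤ q := by positivity
  have hq1 : q < 1 := by rw [hq, div_lt_one (by positivity)]; linarith
  obtain ⟨B, hB⟩ := (tendsto_pow_const_mul_const_pow_of_abs_lt_one 2
    (r := q) (by rwa [abs_of_nonneg hq0])).bddAbove_range
  have hB' : ∀ n : ℕ, (n : ℝ) ^ 2 * q ^ n ≤ B := fun n => hB ⟨n, rfl⟩
  have hB0 : 0 ≤ B := by simpa using hB' 0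
  have key : ∀ n : ℕ, ((n : ℝ) + 1) * (n + 2) * (τ + ε / 2) ^ n ≤ (4 * B + 2) * (τ + ε) ^ n := by
    intro n
    have h1 : (τ + ε / 2) ^ n = q ^ n * (τ + ε) ^ n := by
      rw [hq, div_pow, div_mul_cancel₀]; positivity
    rw [h1, ← mul_assoc]
    gcongr
    have h2 : ((n : ℝ) + 1) * (n + 2) ≤ 4 * n ^ 2 + 2 := by
      rcases Nat.eq_zero_or_pos n with rfl | hn
      · norm_num
      · have : (1 : ℝ) ≤ n := by exact_mod_cast hn
        nlinarith
    have h3 : q ^ n ≤ 1 := pow_le_one₀ hq0 hq1.le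
    have h4 : 0 ≤ q ^ n := by positivity
    calc ((n : ℝ) + 1) * (n + 2) * q ^ n ≤ (4 * n ^ 2 + 2) * q ^ n := by gcongr
      _ = 4 * (n ^ 2 * q ^ n) + 2 * q ^ n := by ring
      _ ≤ 4 * B + 2 * 1 := by gcongr; exact hB' n
      _ = _ := by ring
  refine ⟨C * (4 * B + 2) * (τ + ε / 2) ^ 2, by positivity, fun p r hr => (h (p + 1) r hr).trans ?_⟩
  have hk := key (2 * p)
  have hf : (Nat.factorial (2 * (p + 1)) : ℝ)
      = (((2 * p : ℕ) : ℝ) + 1) * ((2 * p : ℕ) + 2) * Nat.factorial (2 * p) := by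
    rw [show 2 * (p + 1) = 2 * p + 1 + 1 by ring, Nat.factorial_succ, Nat.factorial_succ]
    push_cast; ring
  rw [hf, show 2 * (p + 1) = 2 * p + 2 by ring, pow_add]
  calc _ = C * (Nat.factorial (2 * p)) * (τ + ε / 2) ^ 2
        * ((((2 * p : ℕ) : ℝ) + 1) * ((2 * p : ℕ) + 2) * (τ + ε / 2) ^ (2 * p)) := by ring
    _ ≤ C * (Nat.factorial (2 * p)) * (τ + ε / 2) ^ 2 * ((4 * B + 2) * (τ + ε) ^ (2 * p)) := by
        gcongr
    _ = _ := by ring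

lemma HasGrowthType.add {I : Set ℝ} {τ : ℝ} {y z : ℕ → ℝ → ℂ}
    (hy : HasGrowthType I τ y) (hz : HasGrowthType I τ z) :
    HasGrowthType I τ (fun p r => y p r + z p r) := by
  intro a b hab ε hε
  obtain ⟨C, hC, h⟩ := hy a b hab ε hε
  obtain ⟨D, hD, h'⟩ := hz a b hab ε hε
  refine ⟨C + D, by positivity, fun p r hr => (norm_add_le _ _).trans ?_⟩
  rw [add_mul, add_mul]
  exact add_le_add (h p r hr) (h' p r hr)

lemma HasGrowthType.continuousOn_mul {I : Set ℝ} {τ : ℝ} {y : ℕ → ℝ → ℂ}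
    (hy : HasGrowthType I τ y) {m : ℝ → ℂ} (hm : ContinuousOn m I) :
    HasGrowthType I τ (fun p r => m r * y p r) := by
  intro a b hab ε hε
  obtain ⟨C, hC, h⟩ := hy a b hab ε hε
  obtain ⟨D, hD⟩ := isCompact_Icc.exists_bound_of_continuousOn (hm.mono hab)
  refine ⟨max D 0 * C, by positivity, fun p r hr => ?_⟩
  rw [norm_mul, mul_assoc, mul_assoc, ← mul_assoc C]
  exact mul_le_mul ((hD r hr).trans (le_max_left _ _)) (h p r hr) (norm_nonneg _) (by positivity)

/-! ### Radial chains, the Landau estimate and lowering of the order -/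

lemma hasDerivAt_ofReal_pow (n : ℕ) (r : ℝ) :
    HasDerivAt (fun t : ℝ => (t : ℂ) ^ (n + 1)) ((n + 1 : ℂ) * (r : ℂ) ^ n) r := by
  simpa using (hasDerivAt_pow (n + 1) (r : ℂ)).comp_ofReal

lemma hasDerivAt_ofReal_pow_inv (n : ℕ) {r : ℝ} (hr : r ≠ 0) :
    HasDerivAt (fun t : ℝ => ((t : ℂ) ^ (n + 1))⁻¹) (-(n + 1 : ℂ) * ((r : ℂ) ^ (n + 2))⁻¹) r := by
  have hr' : (r : ℂ) ≠ 0 := by exact_mod_cast hr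
  have h := (hasDerivAt_ofReal_pow n r).inv (pow_ne_zero _ hr')
  refine h.congr_deriv ?_
  field_simp
  ring

/-- The functions `y p` and `v p` satisfy `y p' = r^(2n) v p` and `v p' = r^(-2n) y (p + 1)`,
so that `y (p + 1) = y p'' - (2n / r) y p'`. -/
structure IsRadialChain (I : Set ℝ) (n : ℕ) (y v : ℕ → ℝ → ℂ) : Prop where
  deriv_fst : ∀ p, ∀ r ∈ I, HasDerivAt (y p) ((r : ℂ) ^ (2 * n) * v p r) r
  deriv_snd : ∀ p, ∀ r ∈ I, HasDerivAt (v p) (((r : ℂ) ^ (2 * n))⁻¹ * y (p + 1) r) r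

/-- Landau type estimate of the first derivative by the function and its second derivative. -/
lemma IsRadialChain.hasGrowthType_snd {I : Set ℝ} (hI : IsOpen I) (hpos : ∀ r ∈ I, 0 < r)
    {τ : ℝ} (hτ : 0 ≤ τ) {n : ℕ} {y v : ℕ → ℝ → ℂ} (h : IsRadialChain I n y v)
    (hy : HasGrowthType I τ y) : HasGrowthType I τ v := by
  intro a b hab ε hε
  rcases lt_or_ge b a with hba | hba
  · exact ⟨0, le_rfl, fun p r hr => absurd (hr.1.trans hr.2) (not_le.2 hba)⟩
  -- A strictly longer interval is needed: for `a = b` the constant `D` below would vanish.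
  obtain ⟨b', hb', hbI⟩ : ∃ b' > b, Icc a b' ⊆ I := by
    obtain ⟨δ, hδ, hδI⟩ := Metric.isOpen_iff.1 hI b (hab ⟨hba, le_rfl⟩)
    refine ⟨b + δ / 2, by linarith, fun x hx => ?_⟩
    rcases le_total x b with hxb | hxb
    · exact hab ⟨hx.1, hxb⟩
    · apply hδI
      rw [Metric.mem_ball, Real.dist_eq, abs_of_nonneg (by linarith)]
      linarith [hx.2]
  have ha : 0 < a := hpos a (hab ⟨le_rfl, hba⟩)
  have hab' : a < b' := by linarith
  obtain ⟨C₁, hC₁, h₁⟩ := hy a b' hbI ε hε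
  obtain ⟨C₂, hC₂, h₂⟩ := hy.shift hτ a b' hbI ε hε
  -- `D` is the integral of `r^(2n)` over `[a, b']`.
  set D : ℝ := (b' ^ (2 * n + 1) - a ^ (2 * n + 1)) / (2 * n + 1) with hD
  have hDpos : 0 < D := by
    have := pow_lt_pow_left₀ hab' ha.le (Nat.succ_ne_zero (2 * n))
    exact div_pos (sub_pos.2 this) (by positivity)
  set E : ℝ := b' ^ (2 * n) * ((a ^ (2 * n))⁻¹ * C₂ * (b' - a)) * (b' - a) with hE
  have hba' : 0 ≤ b' - a := by linarith
  have hE0 : 0 ≤ E := by have := ha.trans hab'; positivity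
  refine ⟨(C₁ + C₁ + E) / D, by positivity, fun p x hx => ?_⟩
  have hx' : x ∈ Icc a b' := ⟨hx.1, hx.2.trans hb'.le⟩
  set G : ℝ := (Nat.factorial (2 * p) : ℝ) * (τ + ε) ^ (2 * p) with hG
  have hG0 : 0 ≤ G := by positivity
  -- The oscillation of `v p` is controlled by `y (p + 1)`, through `v p' = r^(-2n) y (p + 1)`.
  have hv : ∀ r ∈ Icc a b', ‖v p r - v p x‖ ≤ (a ^ (2 * n))⁻¹ * C₂ * (b' - a) * G := by
    intro r hr
    have := (convex_Icc a b').norm_image_sub_le_of_norm_hasDerivWithin_le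
      (f := v p) (C := (a ^ (2 * n))⁻¹ * (C₂ * G))
      (fun t ht => (h.deriv_snd p t (hbI ht)).hasDerivWithinAt) (fun t ht => ?_) hx' hr
    · refine this.trans ?_
      have : ‖r - x‖ ≤ b' - a := by
        rw [Real.norm_eq_abs, abs_le]; constructor <;> linarith [hr.1, hr.2, hx'.1, hx'.2]
      calc (a ^ (2 * n))⁻¹ * (C₂ * G) * ‖r - x‖ ≤ (a ^ (2 * n))⁻¹ * (C₂ * G) * (b' - a) := by gcongr
        _ = _ := by ring
    · have ht0 : 0 < t := hpos t (hbI ht)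
      rw [norm_mul, norm_inv, norm_pow, Complex.norm_real, Real.norm_of_nonneg ht0.le]
      have h3 := h₂ p t ht
      rw [mul_assoc] at h3
      gcongr
      exact ht.1
  -- Freeze `v p` at `x`: the difference of `y p` and the primitive of `r^(2n) v p x` has small
  -- derivative. Its increment over `[a, b']` therefore expresses `v p x * D` by boundary values of
  -- `y p` up to an error `E * G`.
  have hΦ := (convex_Icc a b').norm_image_sub_le_of_norm_hasDerivWithin_le
      (f := fun r : ℝ => y p r - v p x * ((r : ℂ) ^ (2 * n + 1) / (2 * n + 1)))
      (f' := fun r : ℝ => (r : ℂ) ^ (2 * n) * (v p r - v p x))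
      (C := b' ^ (2 * n) * ((a ^ (2 * n))⁻¹ * C₂ * (b' - a) * G))
      (fun t ht => ?_) (fun t ht => ?_) (left_mem_Icc.2 hab'.le) (right_mem_Icc.2 hab'.le)
  · have e1 : ‖b' - a‖ = b' - a := Real.norm_of_nonneg hba'
    rw [e1] at hΦ
    have e2 : v p x * (D : ℂ) = (y p b' - y p a) -
        ((y p b' - v p x * ((b' : ℂ) ^ (2 * n + 1) / (2 * n + 1))) -
         (y p a - v p x * ((a : ℂ) ^ (2 * n + 1) / (2 * n + 1)))) := by
      rw [hD]; push_cast; ring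
    have e3 : ‖v p x‖ * D ≤ (C₁ + C₁ + E) * G := by
      calc ‖v p x‖ * D = ‖v p x * (D : ℂ)‖ := by
            rw [norm_mul, Complex.norm_real, Real.norm_of_nonneg hDpos.le]
        _ ≤ (‖y p b'‖ + ‖y p a‖) + _ := by
            rw [e2]; exact (norm_sub_le _ _).trans (add_le_add (norm_sub_le _ _) hΦ)
        _ ≤ (C₁ * G + C₁ * G) + E * G := by
            have i1 := h₁ p b' (right_mem_Icc.2 hab'.le)
            have i2 := h₁ p a (left_mem_Icc.2 hab'.le)
            rw [mul_assoc] at i1 i2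
            refine add_le_add (add_le_add i1 i2) (le_of_eq ?_)
            rw [hE]; ring
        _ = _ := by ring
    rw [mul_assoc, div_mul_eq_mul_div, le_div_iff₀ hDpos]
    exact e3
  · have hn : (2 * (n : ℂ) + 1) ≠ 0 := by exact_mod_cast Nat.succ_ne_zero (2 * n)
    have := (h.deriv_fst p t (hbI ht)).sub
      (((hasDerivAt_ofReal_pow (2 * n) t).div_const (2 * n + 1 : ℂ)).const_mul (v p x))
    refine (this.congr_deriv ?_).hasDerivWithinAt
    push_cast
    field_simp
  · have ht0 : 0 < t := hpos t (hbI ht)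
    rw [norm_mul, norm_pow, Complex.norm_real, Real.norm_of_nonneg ht0.le]
    have := hv t ht
    have := ht.2
    have hb0 := ha.trans hab'
    gcongr

/-- The operator `y ↦ y' / r` maps chains of order `n + 1` to chains of order `n`. -/
lemma IsRadialChain.descend {I : Set ℝ} (hpos : ∀ r ∈ I, 0 < r) {n : ℕ} {y v : ℕ → ℝ → ℂ}
    (h : IsRadialChain I (n + 1) y v) :
    IsRadialChain I n (fun p r => (r : ℂ) ^ (2 * n + 1) * v p r)
      (fun p r => ((r : ℂ) ^ (2 * n + 1))⁻¹ * y (p + 1) r + (2 * n + 1) * v p r) where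
  deriv_fst p r hr := by
    have hr' : (r : ℂ) ≠ 0 := by exact_mod_cast (hpos r hr).ne'
    refine ((hasDerivAt_ofReal_pow (2 * n) r).mul (h.deriv_snd p r hr)).congr_deriv ?_
    push_cast
    field_simp
    ring
  deriv_snd p r hr := by
    have hr' : (r : ℂ) ≠ 0 := by exact_mod_cast (hpos r hr).ne'
    refine (((hasDerivAt_ofReal_pow_inv (2 * n) (hpos r hr).ne').mul
      (h.deriv_fst (p + 1) r hr)).add ((h.deriv_snd p r hr).const_mul (2 * n + 1 : ℂ))).congr_deriv ?_
    push_cast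
    field_simp
    ring

/-! ### From derivative bounds to a power series about the origin -/

/-- The derivative of a Taylor remainder is the remainder of one order less for the derivative, so
the bound follows by integrating inductively from `0`. -/
lemma norm_sub_taylor_le {M : ℝ} (N : ℕ) (v : ℕ → ℝ → ℂ)
    (hv : ∀ m, ∀ t ∈ Icc (0 : ℝ) 1, HasDerivAt (v m) (v (m + 1) t) t)
    (hM : ∀ t ∈ Icc (0 : ℝ) 1, ‖v N t‖ ≤ M) :
    ∀ t ∈ Icc (0 : ℝ) 1,
      ‖v 0 t - ∑ m ∈ Finset.range N, (t : ℂ) ^ m / (m.factorial : ℂ) * v m 0‖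
        ≤ M * (t ^ N / N.factorial) := by
  induction N generalizing v with
  | zero => intro t ht; simpa using hM t ht
  | succ N ih =>
    have ih' := ih (fun m => v (m + 1)) (fun m => hv (m + 1)) hM
    have hd : ∀ t ∈ Icc (0 : ℝ) 1, HasDerivAt
        (fun t : ℝ => v 0 t - ∑ m ∈ Finset.range (N + 1), (t : ℂ) ^ m / (m.factorial : ℂ) * v m 0)
        (v 1 t - ∑ m ∈ Finset.range N, (t : ℂ) ^ m / (m.factorial : ℂ) * v (m + 1) 0) t := by
      intro t ht
      refine (hv 0 t ht).sub ?_
      simp_rw [Finset.sum_range_succ' _ N]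
      simp only [pow_zero]
      refine HasDerivAt.add_const _ (HasDerivAt.fun_sum fun m _ => ?_)
      refine (((hasDerivAt_ofReal_pow m t).div_const _).mul_const _).congr_deriv ?_
      have : ((m.factorial : ℂ)) ≠ 0 := by exact_mod_cast m.factorial_ne_zero
      have : ((m : ℂ) + 1) ≠ 0 := by exact_mod_cast m.succ_ne_zero
      rw [Nat.factorial_succ]; push_cast
      field_simp
    intro t ht
    have hB : ∀ x : ℝ, HasDerivAt (fun x : ℝ => M * (x ^ (N + 1) / (N + 1).factorial))
        (M * (x ^ N / N.factorial)) x := by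
      intro x
      refine (((hasDerivAt_pow (N + 1) x).div_const _).const_mul M).congr_deriv ?_
      rw [Nat.factorial_succ]; push_cast
      have : ((N : ℝ) + 1) ≠ 0 := by positivity
      field_simp
    refine image_norm_le_of_norm_deriv_right_le_deriv_boundary (a := 0) (b := 1)
      (fun x hx => (hd x hx).continuousAt.continuousWithinAt)
      (fun x hx => (hd x (Ico_subset_Icc_self hx)).hasDerivWithinAt) ?_ hB
      (fun x hx => ih' x (Ico_subset_Icc_self hx)) ht
    rw [Finset.sum_range_succ']
    simp

lemma exists_lt_of_two_mul_lt_one {τ s : ℝ} (h : 2 * τ * s < 1) : ∃ s' > s, 2 * τ * s' < 1 := by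
  have : Tendsto (fun x : ℝ => 2 * τ * x) (𝓝[>] s) (𝓝 (2 * τ * s)) :=
    ((continuous_const.mul continuous_id).tendsto s).mono_left nhdsWithin_le_nhds
  obtain ⟨x, hx, hx'⟩ := ((this.eventually_lt_const h).and self_mem_nhdsWithin).exists
  exact ⟨x, hx', hx⟩

/-- A real function with derivatives of order `m` bounded by `m! (τ + ε)^m` is the sum of a
power series about `0` of radius at least `1 / (2τ)`. -/
lemma exists_powerSeries_of_deriv_growth {I : Set ℝ} (hI : I.OrdConnected)
    (hpos : ∀ r ∈ I, 0 < r) {τ : ℝ} (hτ : 0 ≤ τ) (u : ℕ → ℝ → ℂ)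
    (hu : ∀ m, ∀ r ∈ I, HasDerivAt (u m) (u (m + 1) r) r)
    (hb : ∀ a b : ℝ, Icc a b ⊆ I → ∀ ε : ℝ, 0 < ε → ∃ C : ℝ, 0 ≤ C ∧ ∀ m : ℕ, ∀ r ∈ Icc a b,
      ‖u m r‖ ≤ C * (Nat.factorial m : ℝ) * (τ + ε) ^ m) :
    ∃ c : ℕ → ℂ, (∀ s : ℝ, 0 ≤ s → 2 * τ * s < 1 → Summable fun j => ‖c j‖ * s ^ j) ∧
      ∀ r ∈ I, 2 * τ * r < 1 → u 0 r = ∑' j, c j * (r : ℂ) ^ j := by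
  by_cases hex : ∃ ρ ∈ I, 2 * τ * ρ < 1
  swap
  · exact ⟨0, fun s _ _ => by simp,
      fun r hr hr' => absurd ⟨r, hr, hr'⟩ hex⟩
  obtain ⟨ρ, hρ, hρ1⟩ := hex
  have hρ0 := hpos ρ hρ
  set e : ℕ → ℂ := fun m => u m ρ / (m.factorial : ℂ) with he
  set H : ℂ → ℂ := fun z => ∑' m, e m * (z - ρ) ^ m with hH
  have exε : ∀ T : ℝ, 0 ≤ T → τ * T < 1 → ∃ ε > 0, (τ + ε) * T < 1 := by
    intro T hT h
    refine ⟨(1 - τ * T) / (2 * (T + 1)), div_pos (by linarith) (by linarith), ?_⟩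
    have : (1 - τ * T) / (2 * (T + 1)) * T ≤ (1 - τ * T) / 2 := by
      rw [div_mul_eq_mul_div, div_le_div_iff₀ (by linarith) (by norm_num)]
      nlinarith
    nlinarith
  have hsumm : ∀ T : ℝ, 0 ≤ T → τ * T < 1 → Summable fun m => ‖e m‖ * T ^ m := by
    intro T hT h
    obtain ⟨ε, hε, hεT⟩ := exε T hT h
    obtain ⟨C, hC, hCb⟩ := hb ρ ρ (by simpa using hρ) ε hε
    refine Summable.of_nonneg_of_le (fun m => by positivity) (fun m => ?_)
      ((summable_geometric_of_lt_one (by positivity) hεT).mul_left C)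
    have h1 := hCb m ρ (by simp)
    have h2 : (0 : ℝ) < m.factorial := by positivity
    have h3 : ‖e m‖ ≤ C * (τ + ε) ^ m := by
      rw [he]; simp only [norm_div, Complex.norm_natCast]
      rw [div_le_iff₀ h2]; linarith
    rw [mul_pow, ← mul_assoc]
    gcongr
  have hdiff : ∀ T : ℝ, 0 ≤ T → τ * T < 1 → DifferentiableOn ℂ H (Metric.ball (ρ : ℂ) T) := by
    intro T hT h
    refine Complex.differentiableOn_tsum_of_summable_norm (hsumm T hT h)
      (fun m => by fun_prop) Metric.isOpen_ball (fun m w hw => ?_)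
    rw [norm_mul, norm_pow]
    have : ‖w - ρ‖ ≤ T := by rw [← dist_eq_norm]; exact (Metric.mem_ball.1 hw).le
    gcongr
  -- Re-expansion at `0`: `2τρ < 1` and `2τs < 1` give `τ(s + ρ) < 1`, so the disc of radius `s`
  -- about `0` lies inside the disc of convergence about `ρ`.
  set c : ℕ → ℂ := fun n => (n.factorial : ℂ)⁻¹ * iteratedDeriv n H 0 with hc
  have hT : ∀ z : ℂ, 2 * τ * ‖z‖ < 1 → HasSum (fun n => c n * z ^ n) (H z) := by
    intro z hz
    obtain ⟨s, hs, hs1⟩ := exists_lt_of_two_mul_lt_one hz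
    have hs0 : 0 ≤ s := (norm_nonneg z).trans hs.le
    have hd : DifferentiableOn ℂ H (Metric.ball 0 s) := by
      refine (hdiff (s + ρ) (by positivity) (by linarith)).mono (Metric.ball_subset_ball' ?_)
      rw [dist_zero_left, Complex.norm_real, Real.norm_of_nonneg hρ0.le]
    have := Complex.hasSum_taylorSeries_on_ball hd (z := z) (by simpa using hs)
    simpa [hc, mul_comm, mul_left_comm] using this
  refine ⟨c, fun s hs hs1 => ?_, fun r hr hr1 => ?_⟩
  · have := (hT (s : ℂ) (by rwa [Complex.norm_real, Real.norm_of_nonneg hs])).summable.norm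
    simpa [abs_of_nonneg hs] using this
  · have hr0 := hpos r hr
    rw [(hT (r : ℂ) (by rwa [Complex.norm_real, Real.norm_of_nonneg hr0.le])).tsum_eq]
    -- Both points lie below `1/(2τ)`, so `r` is within the radius `1/τ` of the expansion at `ρ`.
    have hTr : τ * |r - ρ| < 1 := by
      have : |r - ρ| ≤ r + ρ := by rw [abs_le]; constructor <;> linarith
      nlinarith
    obtain ⟨ε, hε, hεT⟩ := exε _ (abs_nonneg (r - ρ)) hTr
    obtain ⟨C, hC, hCb⟩ := hb (min ρ r) (max ρ r)
      (hI.out (by rcases min_choice ρ r with h | h <;> rw [h] <;> assumption)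
        (by rcases max_choice ρ r with h | h <;> rw [h] <;> assumption)) ε hε
    have hseg : ∀ t ∈ Icc (0 : ℝ) 1, ρ + t * (r - ρ) ∈ Icc (min ρ r) (max ρ r) := by
      intro t ht
      rcases le_total ρ r with h | h
      · rw [min_eq_left h, max_eq_right h]; constructor <;> nlinarith [ht.1, ht.2]
      · rw [min_eq_right h, max_eq_left h]; constructor <;> nlinarith [ht.1, ht.2]
    have hsegI : ∀ t ∈ Icc (0 : ℝ) 1, ρ + t * (r - ρ) ∈ I := fun t ht =>
      (hI.out (by rcases min_choice ρ r with h | h <;> rw [h] <;> assumption)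
        (by rcases max_choice ρ r with h | h <;> rw [h] <;> assumption)) (hseg t ht)
    -- Taylor's remainder along the segment from `ρ` to `r`: the `N!` of the growth bound cancels,
    -- leaving a geometric sequence.
    have hrem : ∀ N : ℕ, ‖u 0 r - ∑ m ∈ Finset.range N, e m * ((r : ℂ) - ρ) ^ m‖
        ≤ C * ((τ + ε) * |r - ρ|) ^ N := by
      intro N
      have := norm_sub_taylor_le (M := C * N.factorial * (τ + ε) ^ N * |r - ρ| ^ N) N
        (fun m t => ((r : ℂ) - ρ) ^ m * u m (ρ + t * (r - ρ))) (fun m t ht => ?_) (fun t ht => ?_)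
        1 (by simp)
      · have hN : (N.factorial : ℝ) ≠ 0 := by positivity
        calc _ = _ := by
              congr 1
              simp only [one_mul, add_sub_cancel, pow_zero, Complex.ofReal_one, one_pow, zero_mul,
                add_zero, he]
              congr 1
              refine Finset.sum_congr rfl fun m _ => by ring
          _ ≤ _ := this
          _ = _ := by rw [one_pow, mul_pow]; field_simp
      · have hlin : HasDerivAt (fun t : ℝ => ρ + t * (r - ρ)) (r - ρ) t := by
          simpa using ((hasDerivAt_id t).mul_const (r - ρ)).const_add ρ
        have := ((hu m _ (hsegI t ht)).scomp t hlin).const_mul (((r : ℂ) - ρ) ^ m)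
        refine this.congr_deriv ?_
        rw [Complex.real_smul, pow_succ]; push_cast; ring
      · have h1 := hCb N _ (hseg t ht)
        have h2 : ‖(r : ℂ) - ρ‖ = |r - ρ| := by
          rw [← Complex.ofReal_sub, Complex.norm_real, Real.norm_eq_abs]
        rw [norm_mul, norm_pow, h2, mul_comm]
        gcongr
    have hlim : Tendsto (fun N => ∑ m ∈ Finset.range N, e m * ((r : ℂ) - ρ) ^ m) atTop
        (𝓝 (u 0 r)) := by
      rw [tendsto_iff_norm_sub_tendsto_zero]
      refine squeeze_zero (g := fun N => C * ((τ + ε) * |r - ρ|) ^ N) (fun _ => norm_nonneg _)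
        (fun N => by rw [norm_sub_rev]; exact hrem N) ?_
      simpa using (tendsto_pow_atTop_nhds_zero_of_lt_one (by positivity) hεT).const_mul C
    have hs : Summable fun m => e m * ((r : ℂ) - ρ) ^ m := by
      refine Summable.of_norm ?_
      have := hsumm _ (abs_nonneg (r - ρ)) hTr
      refine this.congr fun m => ?_
      rw [norm_mul, norm_pow, ← Complex.ofReal_sub, Complex.norm_real, Real.norm_eq_abs]
    exact tendsto_nhds_unique hlim hs.hasSum.tendsto_sum_nat

/-! ### Power series for chains of arbitrary order -/

/-- A chain of order `0` is the sequence of even order derivatives of a power series. -/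
lemma IsRadialChain.exists_powerSeries_zero {I : Set ℝ} (hI : I.OrdConnected)
    (hpos : ∀ r ∈ I, 0 < r) {τ : ℝ} (hτ : 0 ≤ τ) {y v : ℕ → ℝ → ℂ}
    (h : IsRadialChain I 0 y v) (hy : HasGrowthType I τ y) (hv : HasGrowthType I τ v) :
    ∃ c : ℕ → ℂ, (∀ s : ℝ, 0 ≤ s → 2 * τ * s < 1 → Summable fun j => ‖c j‖ * s ^ j) ∧
      ∀ r ∈ I, 2 * τ * r < 1 → y 0 r = ∑' j, c j * (r : ℂ) ^ j := by
  have := exists_powerSeries_of_deriv_growth hI hpos hτ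
    (fun m => if Even m then y (m / 2) else v (m / 2)) ?_ ?_
  · simpa using this
  · intro m r hr
    rcases m.even_or_odd' with ⟨p, rfl | rfl⟩
    · have h2 : (2 * p + 1) / 2 = p := by omega
      simpa [h2, parity_simps] using h.deriv_fst p r hr
    · have h1 : (2 * p + 1) / 2 = p := by omega
      have h2 : (2 * p + 1 + 1) / 2 = p + 1 := by omega
      simpa [h1, h2, parity_simps] using h.deriv_snd p r hr
  · intro a b hab ε hε
    obtain ⟨C, hC, h1⟩ := hy a b hab ε hε
    obtain ⟨D, hD, h2⟩ := hv a b hab ε hε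
    -- The odd derivatives carry one more power of `τ + ε` than the bound for `v` supplies, hence
    -- the division.
    refine ⟨max C (D / (τ + ε)), by positivity, fun m r hr => ?_⟩
    rcases m.even_or_odd' with ⟨p, rfl | rfl⟩
    · have h3 : ‖y p r‖ ≤ max C (D / (τ + ε)) * (Nat.factorial (2 * p)) * (τ + ε) ^ (2 * p) :=
        (h1 p r hr).trans (by gcongr; exact le_max_left _ _)
      simpa using h3
    · have h3 : (2 * p + 1) / 2 = p := by omega
      have h4 : ‖v p r‖ ≤ max C (D / (τ + ε)) * (Nat.factorial (2 * p + 1))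
          * (τ + ε) ^ (2 * p + 1) := by
        calc _ ≤ _ := h2 p r hr
          _ = D / (τ + ε) * (Nat.factorial (2 * p)) * (τ + ε) ^ (2 * p + 1) := by
            rw [pow_succ]; field_simp
          _ ≤ _ := by
            gcongr
            · exact le_max_right _ _
            · omega
      simpa [h3, parity_simps] using h4

/-- This inverts `y ↦ y'/r` on power series: a primitive of `r Σ c_j r^j` has its indices shifted by
two. -/
lemma hasDerivAt_tsum_powerSeries {c : ℕ → ℂ} {r s : ℝ} (hr : 0 < r) (hrs : r < s)
    (hc : Summable fun j => ‖c j‖ * s ^ j) :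
    HasDerivAt (fun t : ℝ => ∑' j, c j / (j + 2) * (t : ℂ) ^ (j + 2))
      (r * ∑' j, c j * (r : ℂ) ^ j) r := by
  have hs : 0 < s := hr.trans hrs
  have h := hasDerivAt_tsum_of_isPreconnected (𝕜 := ℝ) (t := Ioo (-s) s) (y₀ := 0) (y := r)
    (g := fun (j : ℕ) (t : ℝ) => c j / (j + 2) * (t : ℂ) ^ (j + 2))
    (g' := fun (j : ℕ) (t : ℝ) => t * (c j * (t : ℂ) ^ j))
    (hc.mul_left s) isOpen_Ioo isPreconnected_Ioo ?_ ?_ (by simp [hs]) ?_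
    ⟨by linarith, hrs⟩
  · rwa [tsum_mul_left] at h
  · intro j t _
    refine ((hasDerivAt_ofReal_pow (j + 1) t).const_mul (c j / (j + 2))).congr_deriv ?_
    have : ((j : ℂ) + 2) ≠ 0 := by exact_mod_cast Nat.succ_ne_zero (j + 1)
    push_cast
    field_simp
    ring
  · intro j t ht
    have : |t| ≤ s := (abs_lt.2 ht).le
    rw [norm_mul, norm_mul, norm_pow, Complex.norm_real, Real.norm_eq_abs]
    gcongr
  · simp

/-- The first member of a chain of order `n` is a power series without odd terms of order
below `2n`, with radius of convergence at least `1 / (2τ)`. -/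
theorem IsRadialChain.exists_powerSeries {I : Set ℝ} (hIo : IsOpen I) (hI : I.OrdConnected)
    (hpos : ∀ r ∈ I, 0 < r) {τ : ℝ} (hτ : 0 ≤ τ) {n : ℕ} {y v : ℕ → ℝ → ℂ}
    (h : IsRadialChain I n y v) (hy : HasGrowthType I τ y) (hv : HasGrowthType I τ v) :
    ∃ c : ℕ → ℂ, (∀ s : ℝ, 0 ≤ s → 2 * τ * s < 1 → Summable fun j => ‖c j‖ * s ^ j) ∧
      (∀ j, Odd j → j < 2 * n → c j = 0) ∧
      ∀ r ∈ I, 2 * τ * r < 1 → y 0 r = ∑' j, c j * (r : ℂ) ^ j := by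
  induction n generalizing y v with
  | zero =>
    obtain ⟨c, h1, h2⟩ := h.exists_powerSeries_zero hI hpos hτ hy hv
    exact ⟨c, h1, fun j _ hj => absurd hj (by omega), h2⟩
  | succ n ih =>
    have hcont : ContinuousOn (fun r : ℝ => ((r : ℂ) ^ (2 * n + 1))⁻¹) I := by
      refine ContinuousOn.inv₀ (by fun_prop) fun r hr => pow_ne_zero _ ?_
      exact_mod_cast (hpos r hr).ne'
    -- The descended chain starts with `r^(2n+1) v 0 = y 0' / r`. Its growth comes from that of `v`
    -- and of the shifted `y`.
    obtain ⟨c, h1, h2, h3⟩ := ih (h.descend hpos)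
      (hv.continuousOn_mul (m := fun r : ℝ => (r : ℂ) ^ (2 * n + 1)) (by fun_prop))
      (((hy.shift hτ).continuousOn_mul hcont).add
        (hv.continuousOn_mul (m := fun _ => (2 * n + 1 : ℂ)) (by fun_prop)))
    -- The part of `I` on which the series represents the function. It is again an interval, so a
    -- vanishing derivative there gives a constant.
    set J : Set ℝ := I ∩ {r | 2 * τ * r < 1} with hJ
    have hJo : IsOpen J := hIo.inter (isOpen_lt (by fun_prop) continuous_const)
    have hJc : J.OrdConnected := hI.inter ⟨fun x _ z hz w hw => by
      have := hw.2
      simp only [mem_ofPred_eq] at hz ⊢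
      nlinarith⟩
    set S : ℝ → ℂ := fun t => ∑' j, c j / (j + 2) * (t : ℂ) ^ (j + 2) with hS
    have hderiv : ∀ r ∈ J, HasDerivAt (fun t => y 0 t - S t) 0 r := by
      intro r hr
      obtain ⟨s, hs, hs1⟩ := exists_lt_of_two_mul_lt_one hr.2
      have hr0 := hpos r hr.1
      refine ((h.deriv_fst 0 r hr.1).sub
        (hasDerivAt_tsum_powerSeries hr0 hs (h1 s (by linarith) hs1))).congr_deriv ?_
      rw [← h3 r hr.1 hr.2]
      ring
    obtain ⟨c₀, hc₀⟩ : ∃ c₀ : ℂ, ∀ r ∈ J, y 0 r - S r = c₀ := by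
      rcases J.eq_empty_or_nonempty with he | ⟨x, hx⟩
      · exact ⟨0, fun r hr => by simp [he] at hr⟩
      · refine ⟨y 0 x - S x, fun r hr => ?_⟩
        refine hJo.is_const_of_deriv_eq_zero hJc.isPreconnected
          (f := fun t => y 0 t - S t)
          (fun t ht => (hderiv t ht).differentiableAt.differentiableWithinAt)
          (fun t ht => (hderiv t ht).deriv) hr hx
    -- `c₀` is the constant of integration, and the linear term is zero. The range of vanishing odd
    -- coefficients thus grows by two.
    set c' : ℕ → ℂ := fun j => match j with
      | 0 => c₀
      | 1 => 0
      | j + 2 => c j / (j + 2) with hc'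
    have hsum : ∀ s : ℝ, 0 ≤ s → 2 * τ * s < 1 → Summable fun j => ‖c' j‖ * s ^ j := by
      intro s hs hs1
      rw [← summable_nat_add_iff 2]
      refine Summable.of_nonneg_of_le (fun j => by positivity) (fun j => ?_)
        ((h1 s hs hs1).mul_left (s ^ 2))
      have : ‖c' (j + 2)‖ ≤ ‖c j‖ := by
        simp only [hc', norm_div]
        refine div_le_self (norm_nonneg _) ?_
        have : ((j : ℂ) + 2) = ((j + 2 : ℕ) : ℂ) := by push_cast; ring
        rw [this, Complex.norm_natCast]
        push_cast
        linarith [(Nat.cast_nonneg j : (0 : ℝ) ≤ j)]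
      calc ‖c' (j + 2)‖ * s ^ (j + 2) ≤ ‖c j‖ * s ^ (j + 2) := by gcongr
        _ = _ := by ring
    refine ⟨c', hsum, fun j hj hjn => ?_, fun r hr hr1 => ?_⟩
    · match j, hj, hjn with
      | 1, _, _ => rfl
      | j + 2, hj, hjn =>
        have : c j = 0 := h2 j (by simpa [parity_simps] using hj) (by omega)
        simp [hc', this]
    · have hr0 := hpos r hr
      have hsm : Summable fun j => c' j * (r : ℂ) ^ j := by
        refine Summable.of_norm ((hsum r hr0.le hr1).congr fun j => ?_)
        rw [norm_mul, norm_pow, Complex.norm_real, Real.norm_of_nonneg hr0.le]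
      have h4 := hsm.sum_add_tsum_nat_add 2
      have h5 := hc₀ r ⟨hr, hr1⟩
      rw [← h4, sub_eq_iff_eq_add.1 h5]
      simp [Finset.sum_range_succ, hc', hS]

/-! ### Convergence and analyticity of the Laurent-type series -/

/-- The product form of the condition covers `τ = 0`, where the bound is infinite, without a case
distinction. -/
lemma coe_lt_one_div_two_mul_iff (r τ : ℝ≥0) :
    (r : ℝ≥0∞) < 1 / (2 * (τ : ℝ≥0∞)) ↔ 2 * (τ : ℝ) * r < 1 := by
  rcases eq_or_ne τ 0 with rfl | h
  · simp
  · have h2 : (2 * τ : ℝ≥0) ≠ 0 := by positivity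
    have : 1 / (2 * (τ : ℝ≥0∞)) = ((1 / (2 * τ) : ℝ≥0) : ℝ≥0∞) := by
      rw [ENNReal.coe_div h2]; push_cast; rfl
    rw [this, ENNReal.coe_lt_coe, lt_div_iff₀ (by positivity), ← NNReal.coe_lt_coe]
    push_cast
    rw [mul_comm]

lemma mem_annulus_zero_iff (z : ℂ) (τ : ℝ≥0) :
    z ∈ annulus ℂ 0 (1 / (2 * (τ : ℝ≥0∞))) ↔ z ≠ 0 ∧ 2 * (τ : ℝ) * ‖z‖ < 1 := by
  rw [← coe_nnnorm, ← coe_lt_one_div_two_mul_iff]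
  simp [annulus, enorm_eq_nnnorm]

lemma expo_two_mul (d k j : ℕ) : expo d k (2 * j) = ((k + 2 * j : ℕ) : ℤ) := by
  simp [expo]

lemma expo_two_mul_add_one (d k j : ℕ) :
    expo d k (2 * j + 1) = (-(k : ℤ) - d + 2) + ((2 * j : ℕ) : ℤ) := by
  have : (2 * j + 1) / 2 = j := by omega
  simp [expo, this, parity_simps]

lemma summable_of_even_odd {u : ℕ → ℝ} (h₀ : Summable fun j => u (2 * j))
    (h₁ : Summable fun j => u (2 * j + 1)) : Summable u :=
  (HasSum.even_add_odd h₀.hasSum h₁.hasSum).summable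

lemma Summable.even_terms {E : Type*} [NormedAddCommGroup E] [CompleteSpace E] {u : ℕ → E}
    (h : Summable u) : Summable fun j => u (2 * j) :=
  h.comp_injective (i := fun j : ℕ => 2 * j) (fun i j h => by simpa using h)

lemma Summable.odd_terms {E : Type*} [NormedAddCommGroup E] [CompleteSpace E] {u : ℕ → E}
    (h : Summable u) : Summable fun j => u (2 * j + 1) :=
  h.comp_injective (i := fun j : ℕ => 2 * j + 1) (fun i j h => by simpa using h)

section Assembly

variable {τ : ℝ≥0} {d k : ℕ} {a : ℕ → ℂ}

lemma differentiableAt_even_powerSeries {b : ℕ → ℂ} {τ : ℝ≥0}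
    (hb : ∀ s : ℝ, 0 < s → 2 * (τ : ℝ) * s < 1 → Summable fun j => ‖b j‖ * s ^ (2 * j)) {z : ℂ}
    (hz : 2 * (τ : ℝ) * ‖z‖ < 1) :
    DifferentiableAt ℂ (fun z => ∑' j, b j * z ^ (2 * j)) z := by
  obtain ⟨s, hs, hs1⟩ := exists_lt_of_two_mul_lt_one hz
  have hs0 : 0 < s := (norm_nonneg z).trans_lt hs
  refine DifferentiableOn.differentiableAt (s := Metric.ball 0 s) ?_
    (Metric.isOpen_ball.mem_nhds (by simpa using hs))
  refine Complex.differentiableOn_tsum_of_summable_norm (hb s hs0 hs1)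
    (fun m => by fun_prop) Metric.isOpen_ball (fun m w hw => ?_)
  rw [norm_mul, norm_pow]
  have : ‖w‖ ≤ s := by simpa using (Metric.mem_ball.1 hw).le
  gcongr

lemma le_radius_of_even {b : ℕ → ℂ} {τ : ℝ≥0}
    (hb : ∀ s : ℝ, 0 < s → 2 * (τ : ℝ) * s < 1 → Summable fun j => ‖b (2 * j)‖ * s ^ (2 * j)) :
    1 / (2 * (τ : ℝ≥0∞)) ≤
      (FormalMultilinearSeries.ofScalars ℂ (fun n => if Even n then b n else 0) :
        FormalMultilinearSeries ℂ ℂ ℂ).radius := by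
  refine ENNReal.le_of_forall_nnreal_lt fun s hs => ?_
  rw [coe_lt_one_div_two_mul_iff] at hs
  rcases eq_or_ne s 0 with rfl | hs0
  · simp
  refine FormalMultilinearSeries.le_radius_of_summable _ ?_
  refine summable_of_even_odd ?_ ?_
  · simpa [FormalMultilinearSeries.ofScalars_norm] using hb s (by positivity) hs
  · simp [parity_simps]

lemma hasSum_laurentExtension {z : ℂ} (hz : z ≠ 0)
    (h : Summable fun j => ‖a j * z ^ expo d k j‖) :
    HasSum (fun j => a j * z ^ expo d k j) (laurentExtension d k a z) := by
  have hs := h.of_norm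
  have h0 : Summable fun j => a (2 * j) * z ^ expo d k (2 * j) := hs.even_terms
  have h1 : Summable fun j => a (2 * j + 1) * z ^ expo d k (2 * j + 1) := hs.odd_terms
  have := HasSum.even_add_odd (f := fun j => a j * z ^ expo d k j) h0.hasSum h1.hasSum
  convert this using 1
  rw [laurentExtension, evenPart, oddPart, ← tsum_mul_left, ← tsum_mul_left]
  congr 1
  · refine tsum_congr fun j => ?_
    rw [expo_two_mul, zpow_natCast, pow_add]; ring
  · refine tsum_congr fun j => ?_
    rw [expo_two_mul_add_one, zpow_add₀ hz (-(k : ℤ) - d + 2), zpow_natCast]; ring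

/-- On a nonempty compact `K` the modulus has a positive minimum and a maximum below `1/(2τ)`. The
first controls the negative power, the second the power series. -/
lemma exists_summable_bound (hd : 1 < d)
    (h₀ : ∀ s : ℝ, 0 < s → 2 * (τ : ℝ) * s < 1 → Summable fun j => ‖a (2 * j)‖ * s ^ (2 * j))
    (h₁ : ∀ s : ℝ, 0 < s → 2 * (τ : ℝ) * s < 1 → Summable fun j => ‖a (2 * j + 1)‖ * s ^ (2 * j))
    {K : Set ℂ} (hK : IsCompact K) (hKs : K ⊆ annulus ℂ 0 (1 / (2 * (τ : ℝ≥0∞)))) :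
    ∃ u : ℕ → ℝ, Summable u ∧ ∀ j, ∀ z ∈ K, ‖a j * z ^ expo d k j‖ ≤ u j := by
  rcases K.eq_empty_or_nonempty with rfl | hne
  · exact ⟨0, summable_zero, by simp⟩
  have hK' := fun z hz => (mem_annulus_zero_iff z τ).1 (hKs hz)
  obtain ⟨z₀, hz₀, hmin⟩ := hK.exists_isMinOn hne continuous_norm.continuousOn
  obtain ⟨z₁, hz₁, hmax⟩ := hK.exists_isMaxOn hne continuous_norm.continuousOn
  have hm : 0 < ‖z₀‖ := norm_pos_iff.2 (hK' z₀ hz₀).1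
  have hM : 0 < ‖z₁‖ := norm_pos_iff.2 (hK' z₁ hz₁).1
  -- Since `d > 1`, the exponent `-k-d+2` is not positive.
  obtain ⟨q, hq⟩ : ∃ q : ℕ, -(k : ℤ) - d + 2 = -(q : ℤ) := ⟨k + d - 2, by omega⟩
  have hb₀ : ∀ j, ∀ z ∈ K, ‖a (2 * j) * z ^ expo d k (2 * j)‖
      ≤ ‖z₁‖ ^ k * (‖a (2 * j)‖ * ‖z₁‖ ^ (2 * j)) := by
    intro j z hz
    have h2 : ‖z‖ ≤ ‖z₁‖ := hmax hz
    rw [expo_two_mul, zpow_natCast, norm_mul, norm_pow]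
    calc _ ≤ ‖a (2 * j)‖ * ‖z₁‖ ^ (k + 2 * j) := by gcongr
      _ = _ := by ring
  have hb₁ : ∀ j, ∀ z ∈ K, ‖a (2 * j + 1) * z ^ expo d k (2 * j + 1)‖
      ≤ (‖z₀‖ ^ q)⁻¹ * (‖a (2 * j + 1)‖ * ‖z₁‖ ^ (2 * j)) := by
    intro j z hz
    have h2 : ‖z‖ ≤ ‖z₁‖ := hmax hz
    have h3 : ‖z₀‖ ≤ ‖z‖ := hmin hz
    rw [expo_two_mul_add_one, zpow_add₀ (hK' z hz).1, zpow_natCast, hq, zpow_neg, zpow_natCast,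
      norm_mul, norm_mul, norm_inv, norm_pow, norm_pow]
    calc _ ≤ ‖a (2 * j + 1)‖ * ((‖z₀‖ ^ q)⁻¹ * ‖z₁‖ ^ (2 * j)) := by gcongr
      _ = _ := by ring
  refine ⟨fun j => if Even j then ‖z₁‖ ^ k * (‖a j‖ * ‖z₁‖ ^ j)
      else (‖z₀‖ ^ q)⁻¹ * (‖a j‖ * ‖z₁‖ ^ (j - 1)), summable_of_even_odd ?_ ?_, fun j z hz => ?_⟩
  · simpa using (h₀ _ hM (hK' z₁ hz₁).2).mul_left (‖z₁‖ ^ k)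
  · simpa [parity_simps] using (h₁ _ hM (hK' z₁ hz₁).2).mul_left (‖z₀‖ ^ q)⁻¹
  · rcases j.even_or_odd' with ⟨p, rfl | rfl⟩
    · simpa only [even_two_mul, if_true] using hb₀ p z hz
    · simpa [parity_simps] using hb₁ p z hz

/-- All convergence and analyticity properties of the series `laurentExtension`. -/
theorem laurentExtension_convergence (hd : 1 < d)
    (h₀ : ∀ s : ℝ, 0 < s → 2 * (τ : ℝ) * s < 1 → Summable fun j => ‖a (2 * j)‖ * s ^ (2 * j))
    (h₁ : ∀ s : ℝ, 0 < s → 2 * (τ : ℝ) * s < 1 → Summable fun j => ‖a (2 * j + 1)‖ * s ^ (2 * j)) :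
    DifferentiableOn ℂ (laurentExtension d k a) (annulus ℂ 0 (1 / (2 * (τ : ℝ≥0∞)))) ∧
      (∀ z ∈ annulus ℂ 0 (1 / (2 * (τ : ℝ≥0∞))), Summable fun j => ‖a j * z ^ expo d k j‖) ∧
      (∀ K : Set ℂ, IsCompact K → K ⊆ annulus ℂ 0 (1 / (2 * (τ : ℝ≥0∞))) →
        HasSumUniformlyOn (fun j z => a j * z ^ expo d k j) (laurentExtension d k a) K ∧
        SummableUniformlyOn (fun j z => ‖a j * z ^ expo d k j‖) K) ∧
      1 / (2 * (τ : ℝ≥0∞)) ≤ (evenSeries a).radius ∧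
      1 / (2 * (τ : ℝ≥0∞)) ≤ (oddSeries a).radius ∧
      (τ = 0 → Differentiable ℂ (evenPart a) ∧ Differentiable ℂ (oddPart a)) := by
  have hsum : ∀ z ∈ annulus ℂ 0 (1 / (2 * (τ : ℝ≥0∞))),
      Summable fun j => ‖a j * z ^ expo d k j‖ := by
    intro z hz
    obtain ⟨u, hu, hle⟩ := exists_summable_bound (k := k) hd h₀ h₁ (isCompact_singleton (x := z))
      (by simpa using hz)
    exact Summable.of_nonneg_of_le (fun _ => norm_nonneg _) (fun j => hle j z rfl) hu
  refine ⟨fun z hz => ?_, hsum, fun K hK hKs => ?_, le_radius_of_even h₀,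
    le_radius_of_even (b := fun n => a (n + 1)) h₁, ?_⟩
  · obtain ⟨hz0, hz1⟩ := (mem_annulus_zero_iff z τ).1 hz
    refine DifferentiableAt.differentiableWithinAt ?_
    exact ((differentiableAt_id.pow k).mul (differentiableAt_even_powerSeries h₀ hz1)).add
      ((differentiableAt_zpow.2 (Or.inl hz0)).mul (differentiableAt_even_powerSeries h₁ hz1))
  · obtain ⟨u, hu, hle⟩ := exists_summable_bound (k := k) hd h₀ h₁ hK hKs
    constructor
    · refine (HasSumUniformlyOn.of_norm_le_summable hu hle).congr_right fun z hz => ?_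
      exact (hasSum_laurentExtension ((mem_annulus_zero_iff z τ).1 (hKs hz)).1
        (hsum z (hKs hz))).tsum_eq
    · exact (HasSumUniformlyOn.of_norm_le_summable hu
        (fun j z hz => by rw [norm_norm]; exact hle j z hz)).summableUniformlyOn
  · rintro rfl
    exact ⟨fun z => differentiableAt_even_powerSeries h₀ (by simp),
      fun z => differentiableAt_even_powerSeries h₁ (by simp)⟩

end Assembly

/-! ### Separating even and odd coefficients -/

lemma summable_even_coeff {c : ℕ → ℂ} {s : ℝ} (h : Summable fun j => ‖c j‖ * s ^ j) :
    Summable fun j => ‖c (2 * j)‖ * s ^ (2 * j) :=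
  h.comp_injective (i := fun j => 2 * j) (fun i j h => by simpa using h)

lemma summable_odd_coeff {c : ℕ → ℂ} {s : ℝ} (hs : s ≠ 0) (q : ℕ)
    (h : Summable fun j => ‖c j‖ * s ^ j) :
    Summable fun j => ‖c (2 * j + q)‖ * s ^ (2 * j) := by
  have := (h.comp_injective (i := fun j => 2 * j + q) (fun i j h => by simpa using h)).mul_left
    (s ^ q)⁻¹
  refine this.congr fun j => ?_
  simp only [Function.comp_apply, pow_add]
  field_simp

/-- Splitting of a power series without odd terms of order below `2n`. -/
lemma tsum_split_even_odd {c : ℕ → ℂ} {n : ℕ} {x : ℂ}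
    (h : Summable fun j => ‖c j‖ * ‖x‖ ^ j) (hc : ∀ j, Odd j → j < 2 * n → c j = 0) :
    ∑' j, c j * x ^ j = x ^ (2 * n + 1) * ∑' j, c (2 * j + (2 * n + 1)) * x ^ (2 * j)
      + ∑' j, c (2 * j) * x ^ (2 * j) := by
  have hs : Summable fun j => c j * x ^ j := by
    refine Summable.of_norm (h.congr fun j => ?_)
    rw [norm_mul, norm_pow]
  have h0 : Summable fun j => c (2 * j) * x ^ (2 * j) := hs.even_terms
  have h1 : Summable fun j => c (2 * j + 1) * x ^ (2 * j + 1) := hs.odd_terms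
  -- The first `n` odd-index terms vanish by `hc`, so the odd sum may start at the index `2n+1`.
  rw [← tsum_even_add_odd (f := fun j => c j * x ^ j) h0 h1, add_comm, ← tsum_mul_left, ← h1.sum_add_tsum_nat_add n,
    Finset.sum_eq_zero, zero_add]
  · congr 1
    refine tsum_congr fun j => ?_
    rw [show 2 * (j + n) + 1 = 2 * j + (2 * n + 1) by ring, pow_add]
    ring
  · intro j hj
    rw [hc _ (by simp [parity_simps]) (by have := Finset.mem_range.1 hj; omega), zero_mul]

/-! ### Spherical means and rotation invariance -/

/-- By compactness of `X`, `Φ'` is bounded near `t₀` uniformly in `x`, and a constant dominates on a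
finite measure space. -/
lemma hasDerivAt_integral_of_continuousOn {X : Type*} [TopologicalSpace X] [CompactSpace X]
    [MeasurableSpace X] [OpensMeasurableSpace X] [SecondCountableTopology X]
    {μ : Measure X} [IsFiniteMeasure μ]
    {Φ Φ' : ℝ → X → ℂ} {s : Set ℝ} (hs : IsOpen s)
    (hΦ : ContinuousOn (Function.uncurry Φ) (s ×ˢ univ))
    (hΦ' : ContinuousOn (Function.uncurry Φ') (s ×ˢ univ))
    (hd : ∀ t ∈ s, ∀ x, HasDerivAt (fun t => Φ t x) (Φ' t x) t) {t₀ : ℝ} (ht₀ : t₀ ∈ s) :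
    HasDerivAt (fun t => ∫ x, Φ t x ∂μ) (∫ x, Φ' t₀ x ∂μ) t₀ := by
  obtain ⟨ε, hε, hεs⟩ := Metric.nhds_basis_closedBall.mem_iff.1 (hs.mem_nhds ht₀)
  obtain ⟨C, hC⟩ := ((isCompact_closedBall t₀ ε).prod
    (isCompact_univ (X := X))).exists_bound_of_continuousOn (hΦ'.mono (prod_mono hεs subset_rfl))
  have cont : ∀ {Ψ : ℝ → X → ℂ}, ContinuousOn (Function.uncurry Ψ) (s ×ˢ univ) → ∀ t ∈ s,
      Continuous (Ψ t) := fun hΨ t ht =>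
    hΨ.comp_continuous (f := fun x => (t, x)) (by fun_prop) (fun x => ⟨ht, mem_univ _⟩)
  refine (hasDerivAt_integral_of_dominated_loc_of_deriv_le (bound := fun _ => C)
    (Metric.closedBall_mem_nhds t₀ hε) ?_ ?_ ?_ ?_ (integrable_const _) ?_).2
  · filter_upwards [hs.mem_nhds ht₀] with t ht
    exact (cont hΦ t ht).aestronglyMeasurable
  · exact (cont hΦ t₀ ht₀).integrable_of_hasCompactSupport
      (HasCompactSupport.of_compactSpace _)
  · exact (cont hΦ' t₀ ht₀).aestronglyMeasurable
  · exact ae_of_all _ fun x t ht => hC (t, x) ⟨ht, mem_univ _⟩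
  · exact ae_of_all _ fun x t ht => hd t (hεs ht) x

section Sphere

variable {d : ℕ}

local notation "V" => EuclideanSpace ℝ (Fin d)
local notation "S" => Metric.sphere (0 : EuclideanSpace ℝ (Fin d)) 1

/-- The action of a linear isometry on the unit sphere. -/
noncomputable def sphereMap (U : V ≃ₗᵢ[ℝ] V) (θ : S) : S := ⟨U θ.1, by simp⟩

lemma continuous_sphereMap (U : V ≃ₗᵢ[ℝ] V) : Continuous (sphereMap U) :=
  Continuous.subtype_mk (U.continuous.comp continuous_subtype_val) _

open scoped Pointwise in
-- The surface measure of `s` is a multiple of the volume of the cone over `s`. Linear isometries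
-- commute with forming cones and preserve volume.
lemma measurePreserving_sphereMap (U : V ≃ₗᵢ[ℝ] V) :
    MeasurePreserving (sphereMap U) (surfaceMeasure d) (surfaceMeasure d) := by
  refine ⟨(continuous_sphereMap U).measurable, ?_⟩
  ext s hs
  have hs' := (continuous_sphereMap U).measurable hs
  rw [Measure.map_apply (continuous_sphereMap U).measurable hs, surfaceMeasure,
    Measure.toSphere_apply' _ hs', Measure.toSphere_apply' _ hs]
  congr 1
  have : Ioo (0 : ℝ) 1 • ((↑) '' (sphereMap U ⁻¹' s) : Set V)
      = U ⁻¹' (Ioo (0 : ℝ) 1 • ((↑) '' s : Set V)) := by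
    ext x
    simp only [Set.mem_smul, mem_image, mem_preimage]
    constructor
    · rintro ⟨r, hr, _, ⟨θ, hθ, rfl⟩, rfl⟩
      exact ⟨r, hr, _, ⟨_, hθ, rfl⟩, by simp [sphereMap]⟩
    · rintro ⟨r, hr, _, ⟨θ, hθ, rfl⟩, h⟩
      refine ⟨r, hr, _, ⟨sphereMap U.symm θ, ?_, rfl⟩, ?_⟩
      · simpa [sphereMap] using hθ
      · apply U.injective
        simp [sphereMap, h]
  rw [this]
  exact U.measurePreserving.measure_preimage_equiv (f := U.toMeasurableEquiv) _

lemma integral_sphereMap (U : V ≃ₗᵢ[ℝ] V) {u : S → ℂ} (hu : Continuous u) :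
    ∫ θ, u (sphereMap U θ) ∂(surfaceMeasure d) = ∫ θ, u θ ∂(surfaceMeasure d) := by
  have h := measurePreserving_sphereMap U
  conv_rhs => rw [← h.map_eq]
  exact (integral_map h.measurable.aemeasurable hu.aestronglyMeasurable).symm

/-- The derivative of `F` along the linear vector field `B`. -/
noncomputable def linDeriv (B : V →L[ℝ] V) (F : V → ℂ) (x : V) : ℂ := fderiv ℝ F x (B x)

lemma ContDiffOn.linDeriv {G : Set V} (hG : IsOpen G) {F : V → ℂ} (hF : ContDiffOn ℝ ∞ F G)
    (B : V →L[ℝ] V) : ContDiffOn ℝ ∞ (linDeriv B F) G :=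
  (hF.fderiv_of_isOpen hG (m := ∞) (by simp)).clm_apply B.contDiff.contDiffOn

lemma smul_sphere_continuous {G : Set V} {F : V → ℂ} (hF : ContinuousOn F G) {r : ℝ}
    (hr : ∀ θ : S, r • θ.1 ∈ G) : Continuous (fun θ : S => F (r • θ.1)) :=
  hF.comp_continuous (by fun_prop) hr

lemma integrable_of_continuous_sphere {u : S → ℂ} (hu : Continuous u) :
    Integrable u (surfaceMeasure d) :=
  hu.integrable_of_hasCompactSupport (HasCompactSupport.of_compactSpace _)

/-- The one-parameter group of rotations generated by a skew-adjoint map. -/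
lemma exists_rotation_flow {B : V →L[ℝ] V} (hB : B ∈ skewAdjoint (V →L[ℝ] V)) :
    ∃ U : ℝ → (V ≃ₗᵢ[ℝ] V), (∀ x, U 0 x = x) ∧
      (∀ t x, HasDerivAt (fun t => U t x) (B (U t x)) t) ∧
      Continuous fun p : ℝ × V => U p.1 p.2 := by
  let _ : NormedAlgebra ℚ (V →L[ℝ] V) := NormedAlgebra.restrictScalars ℚ ℝ (V →L[ℝ] V)
  have hU : ∀ t : ℝ, NormedSpace.exp (t • B) ∈ unitary (V →L[ℝ] V) := fun t =>
    NormedSpace.exp_mem_unitary_of_mem_skewAdjoint (skewAdjoint.smul_mem t hB)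
  have hd : ∀ t : ℝ, HasDerivAt (fun t : ℝ => NormedSpace.exp (t • B))
      (B * NormedSpace.exp (t • B)) t := fun t => hasDerivAt_exp_smul_const' (𝕂 := ℝ) B t
  refine ⟨fun t => Unitary.linearIsometryEquiv ⟨_, hU t⟩, fun x => ?_, fun t x => ?_, ?_⟩
  · change NormedSpace.exp ((0 : ℝ) • B) x = x
    rw [show (0 : ℝ) • B = 0 from zero_smul ℝ B, NormedSpace.exp_zero]
    rfl
  · have := (hd t).clm_apply (hasDerivAt_const t x)
    rwa [ContinuousLinearMap.map_zero, add_zero] at this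
  · have : Continuous fun t : ℝ => NormedSpace.exp (t • B) :=
      continuous_iff_continuousAt.2 fun t => (hd t).continuousAt
    exact (this.comp continuous_fst).clm_apply continuous_snd

/-- Derivatives along skew-adjoint vector fields have vanishing integral over spheres. -/
lemma integral_linDeriv_eq_zero {G : Set V} (hG : IsOpen G) {u : V → ℂ} (hu : ContDiffOn ℝ ∞ u G)
    {r : ℝ} (hr : ∀ θ : S, r • θ.1 ∈ G) {B : V →L[ℝ] V} (hB : B ∈ skewAdjoint (V →L[ℝ] V)) :
    ∫ θ : S, linDeriv B u (r • θ.1) ∂(surfaceMeasure d) = 0 := by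
  obtain ⟨U, hU0, hder, hcont⟩ := exists_rotation_flow hB
  have hcontU : Continuous fun p : ℝ × S => r • U p.1 p.2.1 :=
    (hcont.comp (continuous_fst.prodMk (continuous_subtype_val.comp continuous_snd))).const_smul r
  have hmem : ∀ t : ℝ, ∀ θ : S, r • U t θ.1 ∈ G := fun t θ => hr (sphereMap (U t) θ)
  -- Differentiate the mean of `u` over the rotated sphere at time `0`; rotation invariance makes
  -- this mean constant.
  have hd := hasDerivAt_integral_of_continuousOn (μ := surfaceMeasure d) (s := univ)
    (Φ := fun t θ => u (r • U t θ.1)) (Φ' := fun t θ => linDeriv B u (r • U t θ.1)) isOpen_univ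
    (hu.continuousOn.comp hcontU.continuousOn fun p _ => hmem p.1 p.2)
    ((hu.linDeriv hG B).continuousOn.comp hcontU.continuousOn fun p _ => hmem p.1 p.2)
    (fun t _ θ => ?_) (mem_univ 0)
  · have hconst : ∀ t : ℝ, ∫ θ : S, u (r • U t θ.1) ∂(surfaceMeasure d)
        = ∫ θ : S, u (r • θ.1) ∂(surfaceMeasure d) := fun t =>
      integral_sphereMap (U t) (u := fun θ : S => u (r • θ.1))
        (smul_sphere_continuous hu.continuousOn hr)
    simp only [hconst] at hd
    have h0 := hd.unique (hasDerivAt_const _ _)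
    simpa [hU0] using h0
  · have h1 : HasFDerivAt u (fderiv ℝ u (r • U t θ.1)) (r • U t θ.1) :=
      ((hu.contDiffAt (hG.mem_nhds (hmem t θ))).differentiableAt (by simp)).hasFDerivAt
    have h2 := h1.comp_hasDerivAt t ((hder t θ.1).const_smul r)
    refine h2.congr_deriv ?_
    simp [linDeriv]

/-- Differentiation of weighted spherical means with respect to the radius. -/
lemma hasDerivAt_sphericalMean {G : Set V} (hG : IsOpen G) {F : V → ℂ} (hF : ContDiffOn ℝ ∞ F G)
    {I : Set ℝ} (hI : IsOpen I) (hIpos : ∀ r ∈ I, 0 < r) (hIG : ∀ r ∈ I, ∀ θ : S, r • θ.1 ∈ G)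
    {w : S → ℂ} (hw : Continuous w) {r : ℝ} (hr : r ∈ I) :
    HasDerivAt (fun r : ℝ => ∫ θ : S, F (r • θ.1) * w θ ∂(surfaceMeasure d))
      ((r : ℂ)⁻¹ * ∫ θ : S, linDeriv (.id ℝ V) F (r • θ.1) * w θ ∂(surfaceMeasure d)) r := by
  have hmaps : MapsTo (fun p : ℝ × S => p.1 • p.2.1) (I ×ˢ univ) G := fun p hp => hIG _ hp.1 _
  have hw' : Continuous fun p : ℝ × S => w p.2 := hw.comp continuous_snd
  have hfd : ContinuousOn (fderiv ℝ F) G :=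
    (hF.fderiv_of_isOpen hG (m := ∞) (by simp)).continuousOn
  have hd := hasDerivAt_integral_of_continuousOn (μ := surfaceMeasure d) (s := I)
    (Φ := fun t θ => F (t • θ.1) * w θ) (Φ' := fun t θ => fderiv ℝ F (t • θ.1) θ.1 * w θ) hI
    ((hF.continuousOn.comp (by fun_prop) hmaps).mul hw'.continuousOn)
    (((hfd.comp (by fun_prop) hmaps).clm_apply (by fun_prop)).mul hw'.continuousOn)
    (fun t ht θ => ?_) hr
  · refine hd.congr_deriv ?_
    -- The Euler field at `rθ` is `rθ`, whereas the radial derivative is along `θ`; hence the factor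
    -- `r⁻¹`.
    rw [← integral_const_mul]
    congr 1 with θ
    have hr0 : (r : ℂ) ≠ 0 := by exact_mod_cast (hIpos r hr).ne'
    simp only [linDeriv, ContinuousLinearMap.id_apply, map_smul, Complex.real_smul]
    field_simp
  · have h1 : HasFDerivAt F (fderiv ℝ F (t • θ.1)) (t • θ.1) :=
      ((hF.contDiffAt (hG.mem_nhds (hIG t ht θ))).differentiableAt (by simp)).hasFDerivAt
    have h2 := h1.comp_hasDerivAt t ((hasDerivAt_id t).smul_const θ.1)
    simpa using h2.mul_const (w θ)

/-- The field `x ↦ B x` is its own derivative, which produces the first order term along `B (B x)`.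
-/
lemma linDeriv_linDeriv {F : V → ℂ} {x : V} (hF : ContDiffAt ℝ ∞ F x) (B : V →L[ℝ] V) :
    linDeriv B (linDeriv B F) x = fderiv ℝ (fderiv ℝ F) x (B x) (B x) + fderiv ℝ F x (B (B x)) := by
  have h1 : DifferentiableAt ℝ (fderiv ℝ F) x :=
    (hF.fderiv_right (m := ∞) (by simp)).differentiableAt (by simp)
  have h2 := h1.hasFDerivAt.clm_apply B.hasFDerivAt
  have h3 : fderiv ℝ (linDeriv B F) x = _ := h2.fderiv
  rw [linDeriv, h3]
  simp [add_comm]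

lemma linDeriv_mul {F Q : V → ℂ} {x : V} (hF : DifferentiableAt ℝ F x)
    (hQ : DifferentiableAt ℝ Q x) (B : V →L[ℝ] V) :
    linDeriv B (fun x => F x * Q x) x = linDeriv B F x * Q x + F x * linDeriv B Q x := by
  have : fderiv ℝ (fun x => F x * Q x) x = _ := (hF.hasFDerivAt.mul hQ.hasFDerivAt).fderiv
  rw [linDeriv, this]
  simp [linDeriv]
  ring

lemma linDeriv_sub {F Q : V → ℂ} {x : V} (hF : DifferentiableAt ℝ F x)
    (hQ : DifferentiableAt ℝ Q x) (B : V →L[ℝ] V) :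
    linDeriv B (fun x => F x - Q x) x = linDeriv B F x - linDeriv B Q x := by
  have : fderiv ℝ (fun x => F x - Q x) x = _ := (hF.hasFDerivAt.sub hQ.hasFDerivAt).fderiv
  rw [linDeriv, this]
  simp [linDeriv]

/-- The second order angular derivatives are symmetric on spheres. -/
lemma integral_linDeriv_linDeriv_mul {G : Set V} (hG : IsOpen G) {F Q : V → ℂ}
    (hF : ContDiffOn ℝ ∞ F G) (hQ : ContDiffOn ℝ ∞ Q G) {r : ℝ} (hr : ∀ θ : S, r • θ.1 ∈ G)
    {B : V →L[ℝ] V} (hB : B ∈ skewAdjoint (V →L[ℝ] V)) :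
    ∫ θ : S, linDeriv B (linDeriv B F) (r • θ.1) * Q (r • θ.1) ∂(surfaceMeasure d) =
      ∫ θ : S, F (r • θ.1) * linDeriv B (linDeriv B Q) (r • θ.1) ∂(surfaceMeasure d) := by
  have hF1 := hF.linDeriv hG B
  have hQ1 := hQ.linDeriv hG B
  -- In the derivative of `(BF) Q - F (BQ)` along `B` the mixed terms `(BF)(BQ)` cancel.
  have h := integral_linDeriv_eq_zero hG ((hF1.mul hQ).sub (hF.mul hQ1)) hr hB
  have hdiff : ∀ {H : V → ℂ}, ContDiffOn ℝ ∞ H G → ∀ θ : S, DifferentiableAt ℝ H (r • θ.1) :=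
    fun hH θ => (hH.contDiffAt (hG.mem_nhds (hr θ))).differentiableAt (by simp)
  have e : ∀ θ : S, linDeriv B (fun x => linDeriv B F x * Q x - F x * linDeriv B Q x) (r • θ.1)
      = linDeriv B (linDeriv B F) (r • θ.1) * Q (r • θ.1)
        - F (r • θ.1) * linDeriv B (linDeriv B Q) (r • θ.1) := by
    intro θ
    rw [linDeriv_sub (hdiff (hF1.mul hQ) θ) (hdiff (hF.mul hQ1) θ),
      linDeriv_mul (hdiff hF1 θ) (hdiff hQ θ), linDeriv_mul (hdiff hF θ) (hdiff hQ1 θ)]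
    ring
  have h' : ∫ θ : S, (linDeriv B (linDeriv B F) (r • θ.1) * Q (r • θ.1)
        - F (r • θ.1) * linDeriv B (linDeriv B Q) (r • θ.1)) ∂(surfaceMeasure d) = 0 := by
    rw [← h]
    exact integral_congr_ae (ae_of_all _ fun θ => (e θ).symm)
  rw [integral_sub] at h'
  · exact sub_eq_zero.1 h'
  · exact integrable_of_continuous_sphere
      (smul_sphere_continuous ((hF1.linDeriv hG B).mul hQ).continuousOn hr)
  · exact integrable_of_continuous_sphere
      (smul_sphere_continuous (hF.mul (hQ1.linDeriv hG B)).continuousOn hr)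

/-! ### Infinitesimal rotations and the angular part of the Laplacian -/

/-- The infinitesimal rotation `x ↦ xᵢ eⱼ - xⱼ eᵢ`. -/
noncomputable def infRot (i j : Fin d) : V →L[ℝ] V :=
  (EuclideanSpace.proj i : V →L[ℝ] ℝ).smulRight (EuclideanSpace.single j (1 : ℝ))
    - (EuclideanSpace.proj j : V →L[ℝ] ℝ).smulRight (EuclideanSpace.single i (1 : ℝ))

lemma infRot_apply (i j : Fin d) (x : V) :
    infRot i j x = x i • EuclideanSpace.single j (1 : ℝ) - x j • EuclideanSpace.single i (1 : ℝ) :=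
  rfl

lemma infRot_mem_skewAdjoint (i j : Fin d) : infRot i j ∈ skewAdjoint (V →L[ℝ] V) := by
  rw [skewAdjoint.mem_iff, ContinuousLinearMap.star_eq_adjoint, eq_comm,
    ContinuousLinearMap.eq_adjoint_iff]
  intro x y
  simp [infRot_apply, inner_sub_left, inner_sub_right, inner_smul_left, inner_smul_right,
    EuclideanSpace.inner_single_left, EuclideanSpace.inner_single_right]
  ring

lemma sum_smul_single (x : V) : ∑ i, x i • EuclideanSpace.single i (1 : ℝ) = x := by
  ext j
  simp [Pi.single_apply]

lemma laplacian_eq_sum_fderiv (F : V → ℂ) (x : V) :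
    Δ F x = ∑ i, fderiv ℝ (fderiv ℝ F) x (EuclideanSpace.single i (1 : ℝ))
      (EuclideanSpace.single i (1 : ℝ)) := by
  rw [InnerProductSpace.laplacian_eq_iteratedFDeriv_orthonormalBasis F
    (EuclideanSpace.basisFun (Fin d) ℝ)]
  simp [iteratedFDeriv_two_apply]

lemma sum_bilin_infRot (T : V →L[ℝ] V →L[ℝ] ℂ) (x : V) :
    ∑ i, ∑ j, T (infRot i j x) (infRot i j x) =
      2 * ((‖x‖ ^ 2 : ℝ) * ∑ i, T (EuclideanSpace.single i (1 : ℝ)) (EuclideanSpace.single i (1 : ℝ))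
        - T x x) := by
  set e : Fin d → V := fun i => EuclideanSpace.single i (1 : ℝ) with he
  have h1 : ∀ i j, T (infRot i j x) (infRot i j x) =
      (x i : ℂ) ^ 2 * T (e j) (e j) - (x i : ℂ) * x j * T (e j) (e i)
        - (x j : ℂ) * x i * T (e i) (e j) + (x j : ℂ) ^ 2 * T (e i) (e i) := by
    intro i j
    simp only [infRot_apply, map_sub, map_smul, _root_.sub_apply,
      _root_.smul_apply, Complex.real_smul, he]
    ring
  have h2 : T x x = ∑ i, ∑ j, (x i : ℂ) * x j * T (e i) (e j) := by
    conv_lhs => rw [← sum_smul_single x]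
    simp only [map_sum, map_smul, _root_.sum_apply, _root_.smul_apply,
      Complex.real_smul, he, Finset.mul_sum, mul_assoc]
    rw [Finset.sum_comm]
    refine Finset.sum_congr rfl fun i _ => Finset.sum_congr rfl fun j _ => by ring
  have h3 : ((‖x‖ ^ 2 : ℝ) : ℂ) = ∑ i, (x i : ℂ) ^ 2 := by
    rw [EuclideanSpace.real_norm_sq_eq]; push_cast; rfl
  simp only [h1, Finset.sum_add_distrib, Finset.sum_sub_distrib]
  have h4 : ∑ i, ∑ j, (x i : ℂ) * x j * T (e j) (e i) = T x x := by
    rw [h2, Finset.sum_comm]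
    refine Finset.sum_congr rfl fun i _ => Finset.sum_congr rfl fun j _ => by ring
  have h5 : ∑ i, ∑ j, (x j : ℂ) * x i * T (e i) (e j) = T x x := by
    rw [h2]
    refine Finset.sum_congr rfl fun i _ => Finset.sum_congr rfl fun j _ => by ring
  have h6 : ∑ i, ∑ j, (x i : ℂ) ^ 2 * T (e j) (e j)
      = ((‖x‖ ^ 2 : ℝ) : ℂ) * ∑ i, T (e i) (e i) := by
    rw [h3, Finset.sum_mul_sum]
  have h7 : ∑ i, ∑ j, (x j : ℂ) ^ 2 * T (e i) (e i)
      = ((‖x‖ ^ 2 : ℝ) : ℂ) * ∑ i, T (e i) (e i) := by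
    rw [← h6, Finset.sum_comm]
  rw [h4, h5, h6, h7]
  ring

/-- For `i ≠ j` the square of `infRot i j` is minus the projection to the `(i, j)` coordinate plane,
and each coordinate occurs in `2(d-1)` ordered pairs. -/
lemma sum_infRot_infRot (x : V) :
    ∑ i, ∑ j, infRot i j (infRot i j x) = (2 - 2 * (d : ℝ)) • x := by
  have h : ∀ i j, infRot i j (infRot i j x) =
      (if i = j then x i • EuclideanSpace.single i (1 : ℝ) else 0)
        - x j • EuclideanSpace.single j (1 : ℝ) - x i • EuclideanSpace.single i (1 : ℝ)
        + (if i = j then x i • EuclideanSpace.single i (1 : ℝ) else 0) := by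
    intro i j
    by_cases hij : i = j
    · subst hij
      simp [infRot_apply]
    · simp [infRot_apply, hij, Ne.symm hij]
  simp only [h, Finset.sum_add_distrib, Finset.sum_sub_distrib, Finset.sum_ite_eq,
    Finset.mem_univ, if_true, sum_smul_single, Finset.sum_const, Finset.card_univ,
    Fintype.card_fin, ← Finset.smul_sum]
  rw [← Nat.cast_smul_eq_nsmul ℝ]
  module

/-- The decomposition of the Laplacian into its radial and its angular part. -/
lemma sum_linDeriv_infRot {F : V → ℂ} {x : V} (hF : ContDiffAt ℝ ∞ F x) :
    ∑ i, ∑ j, linDeriv (infRot i j) (linDeriv (infRot i j) F) x =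
      2 * ((‖x‖ ^ 2 : ℝ) * Δ F x - linDeriv (.id ℝ V) (linDeriv (.id ℝ V) F) x
        - (d - 2) * linDeriv (.id ℝ V) F x) := by
  -- The squared Euler field contributes `D²F(x, x)` plus a first order term, which turns the
  -- coefficient `d-1` into `d-2`.
  simp only [linDeriv_linDeriv hF, Finset.sum_add_distrib, sum_bilin_infRot, ← map_sum,
    sum_infRot_infRot, ← laplacian_eq_sum_fderiv, ContinuousLinearMap.id_apply]
  simp only [linDeriv, map_smul, Complex.real_smul, ContinuousLinearMap.id_apply]
  push_cast
  ring

end Sphere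

/-! ### Harmonic polynomials and the radial differential equation -/

section Polynomial

variable {d : ℕ}

lemma hasFDerivAt_evalReal (q : MvPolynomial (Fin d) ℂ) (x : EuclideanSpace ℝ (Fin d)) :
    HasFDerivAt (evalReal q) (∑ i, (EuclideanSpace.proj i :
      EuclideanSpace ℝ (Fin d) →L[ℝ] ℝ).smulRight (evalReal (MvPolynomial.pderiv i q) x)) x := by
  induction q using MvPolynomial.induction_on with
  | C a =>
    have : evalReal (MvPolynomial.C a : MvPolynomial (Fin d) ℂ) = fun _ => a := by
      ext y; simp [evalReal]
    rw [this]
    refine (hasFDerivAt_const a x).congr_fderiv ?_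
    ext v
    simp [evalReal]
  | add p q hp hq =>
    have : evalReal (p + q) = fun y => evalReal p y + evalReal q y := by
      ext y; simp [evalReal]
    rw [this]
    refine (hp.add hq).congr_fderiv ?_
    ext v
    simp [evalReal, Finset.sum_add_distrib]
  | mul_X p j hp =>
    have : evalReal (p * MvPolynomial.X j) = fun y => evalReal p y * (y j : ℂ) := by
      ext y; simp [evalReal]
    rw [this]
    have hj : HasFDerivAt (fun y : EuclideanSpace ℝ (Fin d) => (y j : ℂ))
        (Complex.ofRealCLM ∘L (EuclideanSpace.proj j : EuclideanSpace ℝ (Fin d) →L[ℝ] ℝ)) x :=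
      (Complex.ofRealCLM ∘L (EuclideanSpace.proj j :
        EuclideanSpace ℝ (Fin d) →L[ℝ] ℝ)).hasFDerivAt
    refine (hp.mul hj).congr_fderiv ?_
    ext v
    simp [evalReal, Finset.sum_add_distrib, Pi.single_apply, MvPolynomial.pderiv_X,
      Finset.mul_sum, apply_ite, mul_comm, mul_left_comm]

lemma fderiv_evalReal_apply (q : MvPolynomial (Fin d) ℂ) (x v : EuclideanSpace ℝ (Fin d)) :
    fderiv ℝ (evalReal q) x v = ∑ i, (v i : ℂ) * evalReal (MvPolynomial.pderiv i q) x := by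
  rw [(hasFDerivAt_evalReal q x).fderiv]
  simp

lemma contDiff_evalReal (q : MvPolynomial (Fin d) ℂ) : ContDiff ℝ ∞ (evalReal q) := by
  induction q using MvPolynomial.induction_on with
  | C a =>
    have : evalReal (MvPolynomial.C a : MvPolynomial (Fin d) ℂ) = fun _ => a := by
      ext y; simp [evalReal]
    rw [this]
    exact contDiff_const
  | add p q hp hq =>
    have : evalReal (p + q) = fun y => evalReal p y + evalReal q y := by
      ext y; simp [evalReal]
    rw [this]
    exact hp.add hq
  | mul_X p j hp =>
    have : evalReal (p * MvPolynomial.X j) = fun y => evalReal p y * (y j : ℂ) := by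
      ext y; simp [evalReal]
    rw [this]
    exact hp.mul (Complex.ofRealCLM ∘L (EuclideanSpace.proj j :
        EuclideanSpace ℝ (Fin d) →L[ℝ] ℝ)).contDiff

lemma laplacian_evalReal (q : MvPolynomial (Fin d) ℂ) (x : EuclideanSpace ℝ (Fin d)) :
    Δ (evalReal q) x = evalReal (polyLaplacian d q) x := by
  rw [laplacian_eq_sum_fderiv]
  have h : ∀ i : Fin d, fderiv ℝ (fderiv ℝ (evalReal q)) x (EuclideanSpace.single i (1 : ℝ))
      (EuclideanSpace.single i (1 : ℝ))
      = evalReal (MvPolynomial.pderiv i (MvPolynomial.pderiv i q)) x := by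
    intro i
    have h1 : ∀ p : MvPolynomial (Fin d) ℂ, (fun y => fderiv ℝ (evalReal p) y
        (EuclideanSpace.single i (1 : ℝ))) = evalReal (MvPolynomial.pderiv i p) := by
      intro p
      ext y
      simp [fderiv_evalReal_apply, apply_ite ((↑) : ℝ → ℂ)]
    have h2 : DifferentiableAt ℝ (fderiv ℝ (evalReal q)) x :=
      ((contDiff_evalReal q).contDiffAt.fderiv_right (m := ∞) (by simp)).differentiableAt (by simp)
    have h3 := (h2.hasFDerivAt.clm_apply
      (hasFDerivAt_const (EuclideanSpace.single i (1 : ℝ)) x)).fderiv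
    rw [h1] at h3
    rw [← congrFun (h1 (MvPolynomial.pderiv i q)) x, h3]
    simp
  simp only [h, polyLaplacian, evalReal]
  simp

/-- The polynomial with conjugate coefficients. -/
noncomputable def conjPoly (q : MvPolynomial (Fin d) ℂ) : MvPolynomial (Fin d) ℂ :=
  MvPolynomial.map (starRingEnd ℂ) q

lemma evalReal_conjPoly (q : MvPolynomial (Fin d) ℂ) (x : EuclideanSpace ℝ (Fin d)) :
    evalReal (conjPoly q) x = conj (evalReal q x) := by
  simp only [evalReal, conjPoly, MvPolynomial.eval_map]
  rw [MvPolynomial.eval, MvPolynomial.coe_eval₂Hom, MvPolynomial.eval₂_comp_left]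
  congr 1
  ext i
  simp

/-- The Laplacian has real coefficients, so the conjugated weight in the Fourier-Laplace coefficient
is again a solid harmonic of the same degree. -/
lemma conjPoly_mem_harmonicHomogeneous {k : ℕ} {q : MvPolynomial (Fin d) ℂ}
    (hq : q ∈ harmonicHomogeneous d k) : conjPoly q ∈ harmonicHomogeneous d k := by
  obtain ⟨h1, h2⟩ := hq
  refine ⟨?_, ?_⟩
  · exact MvPolynomial.IsHomogeneous.map h1 _
  · have h : polyLaplacian d (conjPoly q) = conjPoly (polyLaplacian d q) := by
      simp [polyLaplacian, conjPoly, MvPolynomial.pderiv_map]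
    change polyLaplacian d (conjPoly q) = 0
    rw [h, show polyLaplacian d q = 0 from h2]
    simp [conjPoly]

lemma linDeriv_id_evalReal {k : ℕ} {q : MvPolynomial (Fin d) ℂ} (hq : q.IsHomogeneous k) :
    linDeriv (.id ℝ _) (evalReal q) = fun x => (k : ℂ) * evalReal q x := by
  ext x
  have h := congrArg (fun p => evalReal p x) hq.sum_X_mul_pderiv
  simp only [evalReal, map_sum, map_mul, MvPolynomial.eval_X, nsmul_eq_mul, map_natCast] at h
  rw [linDeriv, fderiv_evalReal_apply]
  exact h

lemma linDeriv_id_linDeriv_id_evalReal {k : ℕ} {q : MvPolynomial (Fin d) ℂ}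
    (hq : q.IsHomogeneous k) (x : EuclideanSpace ℝ (Fin d)) :
    linDeriv (.id ℝ _) (linDeriv (.id ℝ _) (evalReal q)) x = (k : ℂ) ^ 2 * evalReal q x := by
  have hdq : DifferentiableAt ℝ (evalReal q) x := (hasFDerivAt_evalReal q x).differentiableAt
  have h := congrFun (linDeriv_id_evalReal hq) x
  rw [linDeriv_id_evalReal hq, linDeriv, fderiv_const_mul hdq]
  rw [linDeriv] at h
  simp only [_root_.smul_apply, h, smul_eq_mul]
  ring

lemma evalReal_smul {k : ℕ} {q : MvPolynomial (Fin d) ℂ} (hq : q.IsHomogeneous k) (r : ℝ)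
    (x : EuclideanSpace ℝ (Fin d)) : evalReal q (r • x) = (r : ℂ) ^ k * evalReal q x := by
  rw [evalReal, evalReal, MvPolynomial.eval_eq', MvPolynomial.eval_eq', Finset.mul_sum]
  refine Finset.sum_congr rfl fun m hm => ?_
  have hk : ∑ i, m i = k := by
    have := hq (MvPolynomial.mem_support_iff.1 hm)
    rwa [show (1 : Fin d → ℕ) = fun _ => 1 from rfl, ← Finsupp.degree_eq_weight_one, Finsupp.degree_eq_sum] at this
  simp only [PiLp.smul_apply, smul_eq_mul, Complex.ofReal_mul, mul_pow, Finset.prod_mul_distrib,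
    Finset.prod_pow_eq_pow_sum, hk]
  ring

lemma laplacian_contDiffOn {G : Set (EuclideanSpace ℝ (Fin d))} (hG : IsOpen G)
    {F : EuclideanSpace ℝ (Fin d) → ℂ} (hF : ContDiffOn ℝ ∞ F G) : ContDiffOn ℝ ∞ (Δ F) G := by
  have h : ContDiffOn ℝ ∞ (fderiv ℝ (fderiv ℝ F)) G :=
    (hF.fderiv_of_isOpen hG (m := ∞) (by simp)).fderiv_of_isOpen hG (m := ∞) (by simp)
  rw [show Δ F = _ from funext (laplacian_eq_sum_fderiv F)]
  exact ContDiffOn.sum fun i _ => (h.clm_apply contDiffOn_const).clm_apply contDiffOn_const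

/-- The Laplacian of `F` in terms of the radial derivatives of the Fourier-Laplace coefficient. -/
lemma integral_laplacian_mul {G : Set (EuclideanSpace ℝ (Fin d))} (hG : IsOpen G)
    {F : EuclideanSpace ℝ (Fin d) → ℂ} (hF : ContDiffOn ℝ ∞ F G) {k : ℕ}
    {q : MvPolynomial (Fin d) ℂ} (hq : q ∈ harmonicHomogeneous d k) {r : ℝ} (hr0 : 0 < r)
    (hr : ∀ θ : Metric.sphere (0 : EuclideanSpace ℝ (Fin d)) 1, r • θ.1 ∈ G) :
    ∫ θ, linDeriv (.id ℝ _) (linDeriv (.id ℝ _) F) (r • θ.1) * evalReal q θ.1 ∂(surfaceMeasure d) =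
      (r : ℂ) ^ 2 * ∫ θ, Δ F (r • θ.1) * evalReal q θ.1 ∂(surfaceMeasure d)
        - (d - 2) * ∫ θ, linDeriv (.id ℝ _) F (r • θ.1) * evalReal q θ.1 ∂(surfaceMeasure d)
        + k * (k + d - 2) * ∫ θ, F (r • θ.1) * evalReal q θ.1 ∂(surfaceMeasure d) := by
  have hhom : q.IsHomogeneous k := hq.1
  have hQ : ContDiffOn ℝ ∞ (evalReal q) G := (contDiff_evalReal q).contDiffOn
  have hΔ := laplacian_contDiffOn hG hF
  have hE := hF.linDeriv hG (.id ℝ _)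
  have hEE := hE.linDeriv hG (.id ℝ _)
  have hΔQ : ∀ x, Δ (evalReal q) x = 0 := fun x => by
    rw [laplacian_evalReal, show polyLaplacian d q = 0 from hq.2]; simp [evalReal]
  have hqc : Continuous fun θ : Metric.sphere (0 : EuclideanSpace ℝ (Fin d)) 1 => evalReal q θ.1 :=
    (contDiff_evalReal q).continuous.comp continuous_subtype_val
  have hint : ∀ {H : EuclideanSpace ℝ (Fin d) → ℂ}, ContDiffOn ℝ ∞ H G →
      Integrable (fun θ : Metric.sphere (0 : EuclideanSpace ℝ (Fin d)) 1 =>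
        H (r • θ.1) * evalReal q θ.1) (surfaceMeasure d) := fun hH =>
    integrable_of_continuous_sphere ((smul_sphere_continuous hH.continuousOn hr).mul hqc)
  -- The angular operator is moved from `F` to `q`, both evaluated on the sphere of radius `r`.
  have hsum : ∫ θ, (∑ i : Fin d, ∑ j : Fin d,
        linDeriv (infRot i j) (linDeriv (infRot i j) F) (r • θ.1)) * evalReal q (r • θ.1)
          ∂(surfaceMeasure d)
      = ∫ θ, F (r • θ.1) * (∑ i : Fin d, ∑ j : Fin d,
        linDeriv (infRot i j) (linDeriv (infRot i j) (evalReal q)) (r • θ.1))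
          ∂(surfaceMeasure d) := by
    simp only [Finset.sum_mul, Finset.mul_sum]
    have i1 : ∀ i j : Fin d, Integrable (fun θ : Metric.sphere (0 : EuclideanSpace ℝ (Fin d)) 1 =>
        linDeriv (infRot i j) (linDeriv (infRot i j) F) (r • θ.1) * evalReal q (r • θ.1))
          (surfaceMeasure d) := fun i j => integrable_of_continuous_sphere
      (smul_sphere_continuous (((hF.linDeriv hG _).linDeriv hG _).mul hQ).continuousOn hr)
    have i2 : ∀ i j : Fin d, Integrable (fun θ : Metric.sphere (0 : EuclideanSpace ℝ (Fin d)) 1 =>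
        F (r • θ.1) * linDeriv (infRot i j) (linDeriv (infRot i j) (evalReal q)) (r • θ.1))
          (surfaceMeasure d) := fun i j => integrable_of_continuous_sphere
      (smul_sphere_continuous (hF.mul ((hQ.linDeriv hG _).linDeriv hG _)).continuousOn hr)
    rw [integral_finsetSum _ fun i _ => integrable_finsetSum _ fun j _ => i1 i j,
      integral_finsetSum _ fun i _ => integrable_finsetSum _ fun j _ => i2 i j]
    refine Finset.sum_congr rfl fun i _ => ?_
    rw [integral_finsetSum _ fun j _ => i1 i j, integral_finsetSum _ fun j _ => i2 i j]
    exact Finset.sum_congr rfl fun j _ =>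
      integral_linDeriv_linDeriv_mul hG hF hQ hr (infRot_mem_skewAdjoint i j)
  have hnorm : ∀ θ : Metric.sphere (0 : EuclideanSpace ℝ (Fin d)) 1, ‖r • θ.1‖ = r := fun θ => by
    rw [norm_smul, norm_eq_of_mem_sphere, mul_one, Real.norm_of_nonneg hr0.le]
  have e1 : ∀ θ : Metric.sphere (0 : EuclideanSpace ℝ (Fin d)) 1, (∑ i : Fin d, ∑ j : Fin d,
        linDeriv (infRot i j) (linDeriv (infRot i j) F) (r • θ.1)) * evalReal q (r • θ.1)
      = 2 * (r : ℂ) ^ k * ((r : ℂ) ^ 2 * (Δ F (r • θ.1) * evalReal q θ.1)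
        - linDeriv (.id ℝ _) (linDeriv (.id ℝ _) F) (r • θ.1) * evalReal q θ.1
        - (d - 2) * (linDeriv (.id ℝ _) F (r • θ.1) * evalReal q θ.1)) := by
    intro θ
    rw [sum_linDeriv_infRot (hF.contDiffAt (hG.mem_nhds (hr θ))), hnorm, evalReal_smul hhom]
    push_cast
    ring
  -- A solid harmonic of degree `k` is an eigenfunction of the angular operator: `-k² - (d-2)k =
  -- -k(k+d-2)`. The common factor `2 r^k` is cancelled at the end.
  have e2 : ∀ θ : Metric.sphere (0 : EuclideanSpace ℝ (Fin d)) 1,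
      F (r • θ.1) * (∑ i : Fin d, ∑ j : Fin d,
        linDeriv (infRot i j) (linDeriv (infRot i j) (evalReal q)) (r • θ.1))
      = 2 * (r : ℂ) ^ k * (-(k * (k + d - 2)) * (F (r • θ.1) * evalReal q θ.1)) := by
    intro θ
    rw [sum_linDeriv_infRot (contDiff_evalReal q).contDiffAt, hΔQ,
      linDeriv_id_linDeriv_id_evalReal hhom, linDeriv_id_evalReal hhom]
    simp only [evalReal_smul hhom]
    ring
  simp only [e1, e2] at hsum
  have i3 := ((hint hΔ).const_mul ((r : ℂ) ^ 2)).sub (hint hEE)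
  simp only [Pi.sub_def] at i3
  rw [integral_const_mul, integral_const_mul, integral_sub i3 ((hint hE).const_mul _),
    integral_sub ((hint hΔ).const_mul _) (hint hEE), integral_const_mul, integral_const_mul,
    integral_const_mul] at hsum
  have h2 : (2 * (r : ℂ) ^ k) ≠ 0 :=
    mul_ne_zero two_ne_zero (pow_ne_zero _ (by exact_mod_cast hr0.ne'))
  have h3 := mul_left_cancel₀ h2 hsum
  linear_combination -h3

end Polynomial

/-! ### The chain formed by the Fourier-Laplace coefficients -/

/-- The radii of the annulus `r₀ < |x| < r₁`. -/
def radii (r₀ : ℝ≥0) (r₁ : ℝ≥0∞) : Set ℝ := {r | (r₀ : ℝ) < r ∧ ENNReal.ofReal r < r₁}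

lemma isOpen_radii (r₀ : ℝ≥0) (r₁ : ℝ≥0∞) : IsOpen (radii r₀ r₁) :=
  (isOpen_lt continuous_const continuous_id).inter
    (isOpen_lt ENNReal.continuous_ofReal continuous_const)

lemma ordConnected_radii (r₀ : ℝ≥0) (r₁ : ℝ≥0∞) : (radii r₀ r₁).OrdConnected :=
  ⟨fun _ hx _ hy _ hz => ⟨hx.1.trans_le hz.1, (ENNReal.ofReal_le_ofReal hz.2).trans_lt hy.2⟩⟩

lemma pos_of_mem_radii {r₀ : ℝ≥0} {r₁ : ℝ≥0∞} {r : ℝ} (hr : r ∈ radii r₀ r₁) : 0 < r :=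
  r₀.2.trans_lt hr.1

lemma isOpen_annulus (E : Type*) [NormedAddCommGroup E] (r₀ r₁ : ℝ≥0∞) :
    IsOpen (annulus E r₀ r₁) :=
  (isOpen_lt continuous_const continuous_enorm).inter (isOpen_lt continuous_enorm continuous_const)

lemma mem_annulus_iff_norm_mem_radii {E : Type*} [NormedAddCommGroup E] {r₀ : ℝ≥0} {r₁ : ℝ≥0∞}
    (x : E) : x ∈ annulus E r₀ r₁ ↔ ‖x‖ ∈ radii r₀ r₁ := by
  simp only [annulus, radii, mem_ofPred_eq, ofReal_norm]
  rw [enorm_eq_nnnorm, ENNReal.coe_lt_coe, ← NNReal.coe_lt_coe, coe_nnnorm]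

section Chain

variable {d : ℕ}

/-- The weighted Fourier-Laplace coefficients of the iterated Laplacians of `f` form a chain. -/
lemma isRadialChain_fourierLaplace {e : ℕ} (hd : d = 2 * e + 3) {r₀ : ℝ≥0} {r₁ : ℝ≥0∞}
    {F : ℕ → EuclideanSpace ℝ (Fin d) → ℂ} {k : ℕ} {q : MvPolynomial (Fin d) ℂ}
    (hq : q ∈ harmonicHomogeneous d k)
    (hF : ∀ p, ContDiffOn ℝ ∞ (F p) (annulus _ r₀ r₁)) (hΔ : ∀ p, F (p + 1) = Δ (F p)) :
    IsRadialChain (radii r₀ r₁) (k + e)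
      (fun p r => (r : ℂ) ^ (k + 2 * e + 1) *
        ∫ θ, F p (r • θ.1) * evalReal q θ.1 ∂(surfaceMeasure d))
      (fun p r => ((r : ℂ) ^ k)⁻¹ * ((k + 2 * e + 1) *
          (∫ θ, F p (r • θ.1) * evalReal q θ.1 ∂(surfaceMeasure d)) +
        ∫ θ, linDeriv (.id ℝ _) (F p) (r • θ.1) * evalReal q θ.1 ∂(surfaceMeasure d))) := by
  have hA := isOpen_annulus (EuclideanSpace ℝ (Fin d)) r₀ r₁
  have hmem : ∀ r ∈ radii r₀ r₁, ∀ θ : Metric.sphere (0 : EuclideanSpace ℝ (Fin d)) 1,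
      r • θ.1 ∈ annulus (EuclideanSpace ℝ (Fin d)) r₀ r₁ := by
    intro r hr θ
    rw [mem_annulus_iff_norm_mem_radii, norm_smul, norm_eq_of_mem_sphere, mul_one,
      Real.norm_of_nonneg (pos_of_mem_radii hr).le]
    exact hr
  have hqc : Continuous fun θ : Metric.sphere (0 : EuclideanSpace ℝ (Fin d)) 1 => evalReal q θ.1 :=
    (contDiff_evalReal q).continuous.comp continuous_subtype_val
  have hg := fun p r (hr : r ∈ radii r₀ r₁) => hasDerivAt_sphericalMean hA (hF p)
    (isOpen_radii r₀ r₁) (fun _ => pos_of_mem_radii) hmem hqc hr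
  have hh := fun p r (hr : r ∈ radii r₀ r₁) => hasDerivAt_sphericalMean hA
    ((hF p).linDeriv hA (.id ℝ _)) (isOpen_radii r₀ r₁) (fun _ => pos_of_mem_radii) hmem hqc hr
  refine ⟨fun p r hr => ?_, fun p r hr => ?_⟩
  · have hr0 : (r : ℂ) ≠ 0 := by exact_mod_cast (pos_of_mem_radii hr).ne'
    refine ((hasDerivAt_ofReal_pow (k + 2 * e) r).mul (hg p r hr)).congr_deriv ?_
    push_cast
    field_simp
    ring
  · have hr0 : (r : ℂ) ≠ 0 := by exact_mod_cast (pos_of_mem_radii hr).ne'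
    have hh' := hh p r hr
    -- The second Euler derivative is traded for the Laplacian. In the derivative of the second
    -- member the terms in `F p` and its Euler derivative then cancel, leaving `r^(1-k)` times the
    -- coefficient of `F (p + 1)`.
    rw [integral_laplacian_mul hA (hF p) hq (pos_of_mem_radii hr) (hmem r hr), ← hΔ p] at hh'
    have hk : HasDerivAt (fun t : ℝ => ((t : ℂ) ^ k)⁻¹) (-(k : ℂ) * ((r : ℂ) ^ (k + 1))⁻¹) r := by
      rcases k with _ | k
      · simpa using hasDerivAt_const r (1 : ℂ)
      · simpa using hasDerivAt_ofReal_pow_inv k (pos_of_mem_radii hr).ne'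
    refine (hk.mul (((hg p r hr).const_mul (k + 2 * e + 1 : ℂ)).add hh')).congr_deriv ?_
    have hd' : (d : ℂ) = 2 * e + 3 := by rw [hd]; push_cast; ring
    rw [hd', Pi.add_apply]
    field_simp
    ring

lemma hasGrowthType_fourierLaplace {r₀ : ℝ≥0} {r₁ : ℝ≥0∞} {τ : ℝ}
    {f : EuclideanSpace ℝ (Fin d) → ℂ}
    (hf : IsPolyharmonicInfiniteOrder (annulus (EuclideanSpace ℝ (Fin d)) r₀ r₁) τ f)
    (q : MvPolynomial (Fin d) ℂ) :
    HasGrowthType (radii r₀ r₁) τ (fun p r =>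
      ∫ θ, ((fun g : EuclideanSpace ℝ (Fin d) → ℂ => Δ g)^[p] f) (r • θ.1) * evalReal q θ.1
        ∂(surfaceMeasure d)) := by
  intro a b hab ε hε
  set K : Set (EuclideanSpace ℝ (Fin d)) := {x | ‖x‖ ∈ Icc a b} with hK
  have hKc : IsCompact K := by
    refine Metric.isCompact_of_isClosed_isBounded (isClosed_Icc.preimage continuous_norm) ?_
    refine (Metric.isBounded_closedBall (x := 0) (r := b)).subset fun x hx => ?_
    simpa using hx.2
  obtain ⟨C, hC, hCb⟩ := hf.2 K hKc
    (fun x hx => (mem_annulus_iff_norm_mem_radii x).2 (hab hx)) ε hε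
  have hqc : Continuous fun θ : Metric.sphere (0 : EuclideanSpace ℝ (Fin d)) 1 => evalReal q θ.1 :=
    (contDiff_evalReal q).continuous.comp continuous_subtype_val
  obtain ⟨D, hD⟩ := isCompact_univ.exists_bound_of_continuousOn hqc.continuousOn
  set M : ℝ := (surfaceMeasure d).real univ with hM
  refine ⟨C * max D 0 * M, by positivity, fun p r hr => ?_⟩
  have hr0 := pos_of_mem_radii (hab hr)
  refine (norm_integral_le_of_norm_le_const
    (C := C * (Nat.factorial (2 * p) : ℝ) * (τ + ε) ^ (2 * p) * max D 0)
    (ae_of_all _ fun θ => ?_)).trans (le_of_eq (by rw [hM]; ring))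
  have hθ : r • θ.1 ∈ K := by
    rw [hK, mem_ofPred_eq, norm_smul, norm_eq_of_mem_sphere, mul_one, Real.norm_of_nonneg hr0.le]
    exact hr
  have h1 := hCb p _ hθ
  rw [norm_mul]
  exact mul_le_mul h1 ((hD θ (mem_univ _)).trans (le_max_left _ _)) (norm_nonneg _)
    ((norm_nonneg _).trans h1)

lemma contDiffOn_iterate_laplacian {G : Set (EuclideanSpace ℝ (Fin d))} (hG : IsOpen G)
    {f : EuclideanSpace ℝ (Fin d) → ℂ} (hf : ContDiffOn ℝ ∞ f G) (p : ℕ) :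
    ContDiffOn ℝ ∞ ((fun g : EuclideanSpace ℝ (Fin d) → ℂ => Δ g)^[p] f) G := by
  induction p with
  | zero => exact hf
  | succ p ih => rw [Function.iterate_succ_apply']; exact laplacian_contDiffOn hG ih

end Chain

/-! ### The expansion of the Fourier-Laplace coefficients -/

theorem mainTheorem2 (d : ℕ) (hd : 1 < d) (hodd : Odd d)
    (Y : ∀ k : ℕ, Module.Basis (Fin (harmonicDim d k)) ℂ (harmonicHomogeneous d k))
    (hY : IsSphereOrthonormal Y)
    (r₀ : ℝ≥0) (r₁ : ℝ≥0∞) (hr : (r₀ : ℝ≥0∞) < r₁)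
    (τ : ℝ≥0) (hτ : (τ : ℝ≥0∞) < 1 / (2 * (r₀ : ℝ≥0∞)))
    (f : EuclideanSpace ℝ (Fin d) → ℂ)
    (hf : IsPolyharmonicInfiniteOrder (annulus (EuclideanSpace ℝ (Fin d)) r₀ r₁) τ f)
    (k : ℕ) (l : Fin (harmonicDim d k)) :
    ∃ a : ℕ → ℂ,
      -- the representation of the coefficient on the part of `(r₀, r₁)` below `1 / (2τ)`
      (∀ r : ℝ≥0, r₀ < r → (r : ℝ≥0∞) < r₁ → (r : ℝ≥0∞) < 1 / (2 * (τ : ℝ≥0∞)) →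
        fourierLaplaceCoeff f (Y k l) r = laurentExtension d k a ((r : ℝ) : ℂ)) ∧
      -- the right-hand side is an analytic extension to `0 < |z| < 1 / (2τ)`
      DifferentiableOn ℂ (laurentExtension d k a) (annulus ℂ 0 (1 / (2 * (τ : ℝ≥0∞)))) ∧
      -- absolute and compact convergence there
      (∀ z ∈ annulus ℂ 0 (1 / (2 * (τ : ℝ≥0∞))), Summable fun j => ‖a j * z ^ expo d k j‖) ∧
      (∀ K : Set ℂ, IsCompact K → K ⊆ annulus ℂ 0 (1 / (2 * (τ : ℝ≥0∞))) →
        HasSumUniformlyOn (fun j z => a j * z ^ expo d k j) (laurentExtension d k a) K ∧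
        SummableUniformlyOn (fun j z => ‖a j * z ^ expo d k j‖) K) ∧
      -- the radii of convergence of the two power series
      1 / (2 * (τ : ℝ≥0∞)) ≤ (evenSeries a).radius ∧
      1 / (2 * (τ : ℝ≥0∞)) ≤ (oddSeries a).radius ∧
      (τ = 0 → Differentiable ℂ (evenPart a) ∧ Differentiable ℂ (oddPart a)) := by
  -- Oddness of `d` enters here: the exponents `k` and `-k-d+2` differ by the odd number `2(k+e)+1`,
  -- so the two families correspond to the two parities.
  obtain ⟨e, he⟩ : ∃ e, d = 2 * e + 3 := by
    obtain ⟨m, hm⟩ := hodd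
    exact ⟨m - 1, by omega⟩
  have hτ0 : (0 : ℝ) ≤ τ := τ.2
  have hA := isOpen_annulus (EuclideanSpace ℝ (Fin d)) r₀ r₁
  set q := conjPoly (Y k l : MvPolynomial (Fin d) ℂ) with hqdef
  have hq : q ∈ harmonicHomogeneous d k := conjPoly_mem_harmonicHomogeneous (Y k l).2
  have hchain := isRadialChain_fourierLaplace he (r₀ := r₀) (r₁ := r₁) hq
    (contDiffOn_iterate_laplacian hA hf.1) (fun p => Function.iterate_succ_apply' _ p f)
  have hy := (hasGrowthType_fourierLaplace hf q).continuousOn_mul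
    (m := fun r : ℝ => (r : ℂ) ^ (k + 2 * e + 1)) (by fun_prop)
  have hv := hchain.hasGrowthType_snd (isOpen_radii r₀ r₁) (fun _ => pos_of_mem_radii) hτ0 hy
  obtain ⟨c, hc, hc0, hsum⟩ := hchain.exists_powerSeries (isOpen_radii r₀ r₁)
    (ordConnected_radii r₀ r₁) (fun _ => pos_of_mem_radii) hτ0 hy hv
  -- The series `c` represents `r^(k+2e+1)` times the coefficient. Its odd terms start at `2(k+e)+1`
  -- and yield `r^k` after division; its even terms yield `r^(-k-d+2)`.
  set a : ℕ → ℂ := fun j => if Even j then c (j + (2 * (k + e) + 1)) else c (j - 1) with ha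
  have ha₀ : ∀ j, a (2 * j) = c (2 * j + (2 * (k + e) + 1)) := fun j => by simp [ha]
  have ha₁ : ∀ j, a (2 * j + 1) = c (2 * j) := fun j => by simp [ha, parity_simps]
  refine ⟨a, fun r hr₀ hr₁ hrτ => ?_, laurentExtension_convergence hd (fun s hs hs1 => ?_)
    (fun s hs hs1 => ?_)⟩
  · have hrI : (r : ℝ) ∈ radii r₀ r₁ := ⟨by exact_mod_cast hr₀, by simpa using hr₁⟩
    have hr2 := (coe_lt_one_div_two_mul_iff r τ).1 hrτ
    have hrpos := pos_of_mem_radii hrI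
    have hr0 : ((r : ℝ) : ℂ) ≠ 0 := by exact_mod_cast hrpos.ne'
    have h := hsum r hrI hr2
    have hn : ‖((r : ℝ) : ℂ)‖ = r := by rw [Complex.norm_real, Real.norm_of_nonneg hrpos.le]
    rw [tsum_split_even_odd (by rw [hn]; exact hc r hrpos.le hr2) hc0] at h
    have hcoeff : fourierLaplaceCoeff f (Y k l) r
        = ∫ θ, f ((r : ℝ) • θ.1) * evalReal q θ.1 ∂(surfaceMeasure d) := by
      simp only [fourierLaplaceCoeff, hqdef, evalReal_conjPoly]
    have hexp : -(k : ℤ) - d + 2 = -((k + 2 * e + 1 : ℕ) : ℤ) := by rw [he]; push_cast; ring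
    rw [hcoeff, laurentExtension, evenPart, oddPart, hexp, zpow_neg, zpow_natCast]
    simp only [ha₀, ha₁]
    have hp : ((r : ℝ) : ℂ) ^ (k + 2 * e + 1) ≠ 0 := pow_ne_zero _ hr0
    apply mul_left_cancel₀ hp
    simp only [Function.iterate_zero, id_eq] at h
    rw [h]
    generalize ∑' j, c (2 * j + (2 * (k + e) + 1)) * ((r : ℝ) : ℂ) ^ (2 * j) = A
    rw [mul_add _ (_ * A), mul_inv_cancel_left₀ hp, ← mul_assoc, ← pow_add]
    congr 3
    ring
  · simp only [ha₀]
    exact summable_odd_coeff hs.ne' _ (hc s hs.le hs1)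
  · simp only [ha₁]
    exact summable_even_coeff (hc s hs.le hs1)
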